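/- Let $V$ be a finite-dimensional real vector space, let $N\subseteq V$ be a $\mathbb{Z}$-structure (a subgroup, free of rank $\dim V$, that generates $V$ over $\mathbb{R}$), and let $M\subseteq V^*$ be its dual, the group of linear forms taking integral values on $N$. An $N$-polycone is a cone generated over $\mathbb{R}_{\ge 0}$ by finitely many elements of $N$; it is sharp if it contains no line; its faces are the sets $\sigma\cap\ker(u)$ with $u\in\sigma^\vee\cap M$, where $\sigma^\vee=\{v\in V^*\mid v(\sigma)\subseteq\mathbb{R}_{\ge0}\}$. Let $\Sigma$ be an $N$-fan, i.e. a finite set of sharp $N$-polycones closed under taking faces and such that the intersection of any two of its members is a face of both, and let $R$ be a commutative ring. Let $\Sigma_1$ be the set of one-dimensional cones in $\Sigma$; for $\rho\in\Sigma_1$ let $\rho_N$ be its minimal generator in $N$, and for $\sigma\in\Sigma$ let $\sigma_1$ be the set of one-dimensional faces of $\sigma$. Let $a:\mathbb{Z}^{\Sigma_1}\to A$ be the cokernel of $M\to\mathbb{Z}^{\Sigma_1}$, $u\mapsto(u(\rho_N))_\rho$, and let $\alpha_\rho\in A$ be the image of the basis element $\delta_\rho$. Let $S=R[Z_\rho\mid\rho\in\Sigma_1]$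 be $A$-graded by $\deg Z_\rho=\alpha_\rho$, let $\widehat Z_\sigma=\prod_{\rho\in\Sigma_1\setminus\sigma_1}Z_\rho$, and let $I=\langle\widehat Z_\sigma\mid\sigma\in\Sigma\rangle_S$. Let $S_{(\sigma)}$ be the degree-zero component of the ring of fractions $S_{\widehat Z_\sigma}$, let $Y_\sigma=\operatorname{Spec}S_{(\sigma)}$, and let $Y_\Sigma(R)$ be the inductive limit of the schemes $Y_\sigma$ over $\Sigma$ (ordered by the face relation), which is the scheme obtained by glueing the $Y_\sigma$ along the open subschemes $Y_{\sigma\cap\tau}$. Let $B\subseteq A$ be a subgroup that is big, i.e. of finite index. Put $S_B=\bigoplus_{\alpha\in B}S_\alpha$, a $B$-graded ring, and $I_B=I\cap S_B$. A graded ideal $\mathfrak a\subseteq S_B$ is $I_B$-saturated if $\mathfrak a=\bigcup_{k\ge0}(\mathfrak a:I_B^k)$. For a graded ideal $\mathfrak a\subseteq S_B$ let $\mathfrak a_{(\sigma)}\subseteq S_{(\sigma)}$ be the degree-zero component of the localization of $\mathfrak a$ at the powers of $\widehat Z_\sigma$ that lie in $S_B$. The subgroup $B$ is small if for every $\sigma\in\Sigma$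 it is contained in the subgroup of $A$ generated by the $\alpha_\rho$ with $\rho\in\Sigma_1\setminus\sigma_1$. **Theorem.** (i) Let $B\subseteq A$ be a big subgroup. For every $I_B$-saturated graded ideal $\mathfrak a$ of $S_B$ there is a unique quasicoherent ideal $\Xi_B(\mathfrak a)$ of $\mathscr O_{Y_\Sigma(R)}$ whose restriction to $Y_\sigma$ is the ideal associated with $\mathfrak a_{(\sigma)}$, for every $\sigma\in\Sigma$. The resulting map $\Xi_B$ from the set of $I_B$-saturated graded ideals of $S_B$ to the set of quasicoherent ideals of $\mathscr O_{Y_\Sigma(R)}$ is surjective, and if $B$ is moreover small, then it is bijective. (ii) Let $\operatorname{Pic}(\Sigma)\subseteq A$ be the image under $a$ of the group of all $(m_\rho(\rho_N))_{\rho\in\Sigma_1}$, where $(m_\sigma)_{\sigma\in\Sigma}$ runs through the families in $M$ such that $m_\sigma-m_\tau$ vanishes on $\tau$ for every face $\tau$ of every $\sigma\in\Sigma$. Then $\operatorname{Pic}(\Sigma)$ is small. If every cone of $\Sigma$ is simplicial (generated by linearly independent vectors), then $\operatorname{Pic}(\Sigma)$ is also big, and hence $\Xi_{\operatorname{Pic}(\Sigma)}$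 is bijective. -/

import Mathlib

open CategoryTheory CategoryTheory.Limits AlgebraicGeometry

universe u v

set_option linter.unusedSectionVars false

namespace Toric

/-- `N` is a `ℤ`-structure on the finite-dimensional real vector space `V`: a subgroup, free of
rank `dim V`, that generates `V` over `ℝ`. -/
class IsZStructure {V : Type v} [AddCommGroup V] [Module ℝ V] (N : AddSubgroup V) : Prop where
  fg : N.FG
  rank : Module.finrank ℤ N = Module.finrank ℝ V
  span : Submodule.span ℝ (N : Set V) = ⊤

/-- The dual `M = N^*`, as the subgroup of the dual space `V^*` of those linear forms that take
integral values on `N`. -/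
def dualLattice {V : Type v} [AddCommGroup V] [Module ℝ V] (N : AddSubgroup V) :
    AddSubgroup (Module.Dual ℝ V) where
  carrier := {u | ∀ x ∈ N, ∃ z : ℤ, u x = z}
  zero_mem' := fun _ _ => ⟨0, by simp⟩
  add_mem' := by
    intro u w hu hw x hx
    obtain ⟨a, ha⟩ := hu x hx
    obtain ⟨b, hb⟩ := hw x hx
    exact ⟨a + b, by simp [ha, hb]⟩
  neg_mem' := by
    intro u hu x hx
    obtain ⟨a, ha⟩ := hu x hx
    exact ⟨-a, by simp [ha]⟩

/-- An `N`-polycone: the cone generated by a finite subset of `N`. -/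
def IsPolycone {V : Type v} [AddCommGroup V] [Module ℝ V] (N : AddSubgroup V)
    (σ : PointedCone ℝ V) : Prop :=
  ∃ s : Finset V, (s : Set V) ⊆ N ∧ σ = PointedCone.hull ℝ (s : Set V)

/-- A cone is sharp if it does not contain a line. -/
def IsSharp {V : Type v} [AddCommGroup V] [Module ℝ V] (σ : PointedCone ℝ V) : Prop :=
  ¬ ∃ x : V, x ≠ 0 ∧ ∀ t : ℝ, t • x ∈ σ

/-- `u` is nonnegative on `σ`, i.e. `u ∈ σ^∨`, and `τ = σ ∩ ker u`. -/
def CutsOut {V : Type v} [AddCommGroup V] [Module ℝ V] (u : Module.Dual ℝ V)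
    (τ σ : PointedCone ℝ V) : Prop :=
  (∀ x ∈ σ, 0 ≤ u x) ∧ ∀ x, x ∈ τ ↔ x ∈ σ ∧ u x = 0

/-- `τ` is a face of `σ`: there is `u ∈ σ^∨ ∩ M` with `τ = σ ∩ ker u`. -/
def IsFace {V : Type v} [AddCommGroup V] [Module ℝ V] (N : AddSubgroup V)
    (τ σ : PointedCone ℝ V) : Prop :=
  ∃ u ∈ dualLattice N, CutsOut u τ σ

/-- An `N`-fan: a finite set of sharp `N`-polycones, closed under taking faces, such that the
intersection of any two members is a face of both. -/
structure Fan {V : Type v} [AddCommGroup V] [Module ℝ V] (N : AddSubgroup V) where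
  cones : Set (PointedCone ℝ V)
  finite : cones.Finite
  polycone : ∀ σ ∈ cones, IsPolycone N σ
  sharp : ∀ σ ∈ cones, IsSharp σ
  face_mem : ∀ σ ∈ cones, ∀ τ, IsFace N τ σ → τ ∈ cones
  inter_face : ∀ σ ∈ cones, ∀ τ ∈ cones, IsFace N (σ ⊓ τ) σ ∧ IsFace N (σ ⊓ τ) τ

namespace Fan

variable {V : Type v} [AddCommGroup V] [Module ℝ V] {N : AddSubgroup V}

/-- The cones of the fan, ordered by inclusion; by `Fan.le_iff_isFace` this is the face order. -/
abbrev Cone (Δ : Fan N) : Type v := {σ : PointedCone ℝ V // σ ∈ Δ.cones}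

instance (Δ : Fan N) : Finite Δ.Cone := Δ.finite.to_subtype

theorem le_iff_isFace (Δ : Fan N) (τ σ : Δ.Cone) : τ ≤ σ ↔ IsFace N τ.1 σ.1 := by
  constructor
  · intro h
    have h1 := (Δ.inter_face σ.1 σ.2 τ.1 τ.2).1
    rwa [inf_eq_right.mpr (show τ.1 ≤ σ.1 from h)] at h1
  · rintro ⟨u, -, hu⟩ x hx
    exact ((hu.2 x).1 hx).1

/-- The set `Σ_1` of one-dimensional cones. -/
abbrev Ray (Δ : Fan N) : Type v :=
  {ρ : Δ.Cone // Module.finrank ℝ (Submodule.span ℝ (ρ.1 : Set V)) = 1}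

noncomputable instance (Δ : Fan N) : Fintype Δ.Ray := Fintype.ofFinite _

/-- `ρ ∈ σ_1`, i.e. the ray `ρ` is a one-dimensional face of `σ`. -/
abbrev IsRayOf (Δ : Fan N) (ρ : Δ.Ray) (σ : Δ.Cone) : Prop := ρ.1 ≤ σ

end Fan

/-- `x` is a minimal `N`-generator of `ρ`. -/
def IsMinGenerator {V : Type v} [AddCommGroup V] [Module ℝ V] (N : AddSubgroup V)
    (ρ : PointedCone ℝ V) (x : V) : Prop :=
  x ∈ N ∧ (∀ y, y ∈ ρ ↔ ∃ r : ℝ, 0 ≤ r ∧ y = r • x) ∧ ∀ r : ℝ, 0 < r → r < 1 → r • x ∉ N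

theorem exists_dual_ne_zero {V : Type v} [AddCommGroup V] [Module ℝ V] [FiniteDimensional ℝ V]
    (N : AddSubgroup V) [IsZStructure N] {x : V} (hx : x ≠ 0) :
    ∃ u ∈ dualLattice N, u x ≠ 0 := by
  have : AddGroup.FG N := (AddGroup.fg_iff_addSubgroup_fg N).mpr IsZStructure.fg
  have : Module.Finite ℤ N := Module.Finite.iff_addGroup_fg.mpr this
  have : IsAddTorsionFree V := by
    let : Module ℚ V := Module.compHom V (algebraMap ℚ ℝ)
    exact .of_module_rat _
  have : Module.Free ℤ N := inferInstance
  let b := Module.finBasis ℤ N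
  have hspan : ∀ y ∈ N, ∃ c : Fin (Module.finrank ℤ N) → ℤ,
      y = ∑ i, c i • (b i : V) := by
    intro y hy
    refine ⟨fun i => b.repr ⟨y, hy⟩ i, ?_⟩
    have h := congrArg (N.subtype) (b.sum_repr ⟨y, hy⟩)
    rw [map_sum] at h
    simp only [map_zsmul, AddSubgroup.subtype_apply] at h
    exact h.symm
  have htop : ⊤ ≤ Submodule.span ℝ (Set.range fun i => (b i : V)) := by
    rw [← IsZStructure.span (N := N)]
    refine Submodule.span_le.mpr fun y hy => ?_
    obtain ⟨c, rfl⟩ := hspan y hy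
    refine Submodule.sum_mem _ fun i _ => ?_
    exact zsmul_mem (Submodule.subset_span (Set.mem_range_self i)) _
  let e := basisOfTopLeSpanOfCardEqFinrank _ htop
    (by rw [Fintype.card_fin]; exact IsZStructure.rank)
  have he : ∀ i, e i = (b i : V) := fun i => by simp [e]
  have : ∃ i, e.coord i x ≠ 0 := by
    by_contra! h
    exact hx (e.forall_coord_eq_zero_iff.mp h)
  obtain ⟨i, hi⟩ := this
  refine ⟨e.coord i, fun y hy => ?_, hi⟩
  obtain ⟨c, rfl⟩ := hspan y hy
  refine ⟨c i, ?_⟩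
  simp only [← he, map_sum, map_zsmul, Module.Basis.coord_apply, Module.Basis.repr_self]
  rw [Finset.sum_eq_single i]
  · simp
  · intro j _ hj
    simp [hj]
  · simp

theorem Fan.exists_isMinGenerator {V : Type v} [AddCommGroup V] [Module ℝ V]
    [FiniteDimensional ℝ V] {N : AddSubgroup V} [IsZStructure N] (Δ : Fan N) (ρ : Δ.Ray) :
    ∃ x, IsMinGenerator N ρ.1.1 x := by
  obtain ⟨s, hsN, hs⟩ := Δ.polycone ρ.1.1 ρ.1.2
  have hsharp := Δ.sharp ρ.1.1 ρ.1.2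
  have hdim := ρ.2
  have hne : ∃ x ∈ s, x ≠ 0 := by
    by_contra! h
    have : ρ.1.1 = ⊥ := by
      rw [hs]
      exact Submodule.span_eq_bot.mpr h
    have h0 : Submodule.span ℝ (ρ.1.1 : Set V) = ⊥ := by
      rw [this]
      simp
    rw [h0, finrank_bot] at hdim
    exact zero_ne_one hdim
  obtain ⟨x₀, hx₀s, hx₀⟩ := hne
  have hx₀ρ : x₀ ∈ ρ.1.1 := by rw [hs]; exact Submodule.subset_span hx₀s
  have hline : ∀ z ∈ ρ.1.1, z ≠ 0 → ∀ y ∈ ρ.1.1, ∃ r : ℝ, 0 ≤ r ∧ y = r • z := by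
    intro z hz hz0 y hy
    have h1 := (finrank_eq_one_iff_of_nonzero'
      (⟨z, Submodule.subset_span hz⟩ : Submodule.span ℝ (ρ.1.1 : Set V))
      (by simpa [Subtype.ext_iff] using hz0)).1 hdim ⟨y, Submodule.subset_span hy⟩
    obtain ⟨c, hc⟩ := h1
    have hc' : y = c • z := by simpa using (congrArg Subtype.val hc).symm
    rcases le_or_gt 0 c with h | h
    · exact ⟨c, h, hc'⟩
    · exfalso
      apply hsharp
      refine ⟨z, hz0, fun t => ?_⟩
      rcases le_or_gt 0 t with ht | ht
      · exact PointedCone.smul_mem _ ht hz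
      · have h2 : t • z = (t / c) • y := by
          rw [hc', smul_smul, div_mul_cancel₀ _ h.ne]
        rw [h2]
        exact PointedCone.smul_mem _ (div_nonneg_of_nonpos ht.le h.le) hy
  obtain ⟨u, huM, hu0⟩ := exists_dual_ne_zero N hx₀
  let P : ℕ → Prop := fun k => ∃ y ∈ N, y ∈ ρ.1.1 ∧ y ≠ 0 ∧ |u y| = k
  have hP : ∃ k, P k := by
    obtain ⟨z, hz⟩ := huM x₀ (hsN hx₀s)
    exact ⟨z.natAbs, x₀, hsN hx₀s, hx₀ρ, hx₀, by rw [hz, Nat.cast_natAbs]; simp⟩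
  classical
  obtain ⟨y, hyN, hyρ, hy0, hyk⟩ := Nat.find_spec hP
  refine ⟨y, hyN, fun z => ⟨hline y hyρ hy0 z, ?_⟩, ?_⟩
  · rintro ⟨r, hr, rfl⟩
    exact PointedCone.smul_mem _ hr hyρ
  · intro r hr0 hr1 hrN
    obtain ⟨z, hz⟩ := huM _ hrN
    have huy : u y ≠ 0 := by
      obtain ⟨c, -, hc⟩ := hline y hyρ hy0 x₀ hx₀ρ
      intro h
      apply hu0
      rw [hc, map_smul, h, smul_zero]
    have hlt : z.natAbs < Nat.find hP := by
      have : (z.natAbs : ℝ) < (Nat.find hP : ℝ) := by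
        rw [← hyk, Nat.cast_natAbs, Int.cast_abs, ← hz, map_smul, smul_eq_mul, abs_mul,
          abs_of_pos hr0]
        have := abs_pos.mpr huy
        nlinarith
      exact_mod_cast this
    refine Nat.find_min hP hlt ⟨r • y, hrN, PointedCone.smul_mem _ hr0.le hyρ,
      smul_ne_zero hr0.ne' hy0, ?_⟩
    rw [hz, Nat.cast_natAbs, Int.cast_abs]

end Toric
namespace Toric

section HomogeneousAway

open HomogeneousLocalization

variable {ι A S : Type*} [CommRing A] [SetLike S A] [AddSubgroupClass S A]
  [AddCommGroup ι] [DecidableEq ι] (𝒜 : ι → S) [GradedRing 𝒜]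

theorem awayMap_self {d : ι} {f g : A} (hf : f ∈ 𝒜 d) (hg : g ∈ 𝒜 0) (hx : f = f * g)
    (hg1 : g = 1) : awayMap 𝒜 hg hx = RingHom.id _ := by
  refine RingHom.ext fun z => ?_
  obtain ⟨n, a, ha, rfl⟩ := Away.mk_surjective 𝒜 hf z
  rw [awayMap_mk]
  apply val_injective
  simp [Away.val_mk, hg1]

theorem awayMap_comp {d₀ d e k : ι} {f g x h y w : A} (hf : f ∈ 𝒜 d₀) (hg : g ∈ 𝒜 d)
    (hx : x = f * g) (hh : h ∈ 𝒜 e) (hy : y = x * h) (hw : w ∈ 𝒜 k) (hy' : y = f * w)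
    (hgh : w = g * h) :
    awayMap 𝒜 hw hy' = (awayMap 𝒜 hh hy).comp (awayMap 𝒜 hg hx) := by
  refine RingHom.ext fun z => ?_
  obtain ⟨n, a, ha, rfl⟩ := Away.mk_surjective 𝒜 hf z
  rw [RingHom.comp_apply, awayMap_mk, awayMap_mk, awayMap_mk]
  apply val_injective
  simp only [Away.val_mk]
  rw [hgh, mul_pow, mul_assoc]

/-- If `x = f g` and `a` is a multiple of `g` and a divisor of a power of `x`, then the degree-zero
part of `A_x` is the localization of the degree-zero part of `A_f` at the fraction `a / f ^ n`. -/
theorem away_isLocalization {d e : ι} {f g x : A} (hf : f ∈ 𝒜 d) (hg : g ∈ 𝒜 e)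
    (hx : x = f * g) (n L : ℕ) {a a' b : A} (ha : a ∈ 𝒜 (n • d)) (ha' : a' ∈ 𝒜 (n • d - e))
    (hb : b ∈ 𝒜 (L • (d + e) - n • d)) (haa' : a = a' * g) (hab : a * b = x ^ L) :
    letI := (awayMap 𝒜 hg hx).toAlgebra
    IsLocalization.Away (Away.mk 𝒜 hf n a ha) (Away 𝒜 x) := by
  let _ := (awayMap 𝒜 hg hx).toAlgebra
  have hxd : x ∈ 𝒜 (d + e) := hx ▸ SetLike.mul_mem_graded hf hg
  have halg : ∀ z, algebraMap (Away 𝒜 f) (Away 𝒜 x) z = awayMap 𝒜 hg hx z := fun _ => rfl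
  refine IsLocalization.Away.mk _ ?_ ?_ ?_
  · have hnum : f ^ n * b ∈ 𝒜 (L • (d + e)) := by
      have := SetLike.mul_mem_graded (SetLike.pow_mem_graded n hf) hb
      rwa [add_sub_cancel] at this
    refine IsUnit.of_mul_eq_one (Away.mk 𝒜 hxd L (f ^ n * b) hnum) ?_
    rw [halg, awayMap_mk]
    apply val_injective
    simp only [val_mul, Away.val_mk, val_one]
    rw [Localization.mk_mul, ← Localization.mk_one, Localization.mk_eq_mk_iff,
      Localization.r_iff_exists]
    refine ⟨1, ?_⟩
    simp only [Submonoid.coe_mul, OneMemClass.coe_one, one_mul, mul_one]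
    calc a * g ^ n * (f ^ n * b) = (a * b) * (f * g) ^ n := by ring
      _ = x ^ n * x ^ L := by rw [hab, ← hx]; ring
  · intro z
    obtain ⟨m, c, hc, rfl⟩ := Away.mk_surjective 𝒜 hxd z
    have hnum : a' ^ m * c ∈ 𝒜 ((m * n + m) • d) := by
      have h1 := SetLike.mul_mem_graded (SetLike.pow_mem_graded m ha') hc
      have h2 : m • (n • d - e) + m • (d + e) = (m * n + m) • d := by
        rw [smul_sub, smul_add, add_smul, mul_smul]; abel
      rwa [h2] at h1
    refine ⟨m, Away.mk 𝒜 hf (m * n + m) (a' ^ m * c) hnum, ?_⟩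
    rw [halg, halg, awayMap_mk, awayMap_mk]
    apply val_injective
    simp only [val_mul, val_pow, Away.val_mk]
    rw [Localization.mk_pow, Localization.mk_mul, Localization.mk_eq_mk_iff,
      Localization.r_iff_exists]
    refine ⟨1, ?_⟩
    simp only [Submonoid.coe_mul, OneMemClass.coe_one, one_mul, SubmonoidClass.mk_pow]
    rw [haa']
    ring
  · intro z w hzw
    obtain ⟨k, c, hc, rfl⟩ := Away.mk_surjective 𝒜 hf z
    obtain ⟨l, c', hc', rfl⟩ := Away.mk_surjective 𝒜 hf w
    rw [halg, halg, awayMap_mk, awayMap_mk] at hzw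
    have h1 := congrArg val hzw
    simp only [Away.val_mk] at h1
    rw [Localization.mk_eq_mk_iff, Localization.r_iff_exists] at h1
    obtain ⟨⟨_, m, rfl⟩, h1⟩ := h1
    simp only at h1
    refine ⟨m + k + l, ?_⟩
    apply val_injective
    simp only [val_mul, val_pow, Away.val_mk]
    rw [Localization.mk_pow, Localization.mk_mul, Localization.mk_mul, Localization.mk_eq_mk_iff,
      Localization.r_iff_exists]
    refine ⟨⟨f ^ m, m, rfl⟩, ?_⟩
    simp only [Submonoid.coe_mul, SubmonoidClass.mk_pow]
    have h2 : f ^ m * (f ^ l * c) * g ^ (m + k + l) = f ^ m * (f ^ k * c') * g ^ (m + k + l) := by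
      rw [hx] at h1
      linear_combination h1
    rw [haa']
    linear_combination a' ^ (m + k + l) * (f ^ n) ^ (m + k + l) * h2

end HomogeneousAway

end Toric

namespace Toric

namespace Fan

section Combinatorics

variable {V : Type v} [AddCommGroup V] [Module ℝ V] [FiniteDimensional ℝ V] {N : AddSubgroup V}
  [IsZStructure N] (Δ : Fan N)

/-- The minimal `N`-generator `ρ_N` of a ray `ρ`. -/
noncomputable def rayGen (ρ : Δ.Ray) : V := (Δ.exists_isMinGenerator ρ).choose

theorem rayGen_spec (ρ : Δ.Ray) : IsMinGenerator N ρ.1.1 (Δ.rayGen ρ) :=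
  (Δ.exists_isMinGenerator ρ).choose_spec

theorem rayGen_unique (ρ : Δ.Ray) {x : V} (hx : IsMinGenerator N ρ.1.1 x) :
    x = Δ.rayGen ρ := by
  obtain ⟨hyN, hy, hymin⟩ := Δ.rayGen_spec ρ
  obtain ⟨hxN, hxr, hxmin⟩ := hx
  obtain ⟨r, hr, hxe⟩ := (hy x).1 ((hxr x).2 ⟨1, zero_le_one, (one_smul _ _).symm⟩)
  obtain ⟨t, ht, hye⟩ := (hxr (Δ.rayGen ρ)).1 ((hy _).2 ⟨1, zero_le_one, (one_smul _ _).symm⟩)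
  have h0 : ¬ r < 1 ∨ r = 0 := by
    by_contra! h
    exact hymin r (lt_of_le_of_ne hr h.2.symm) h.1 (hxe ▸ hxN)
  have h1 : ¬ t < 1 ∨ t = 0 := by
    by_contra! h
    exact hxmin t (lt_of_le_of_ne ht h.2.symm) h.1 (hye ▸ hyN)
  rcases h0 with h0 | h0
  · rcases h1 with h1 | h1
    · by_cases hz : Δ.rayGen ρ = 0
      · rw [hxe, hz, smul_zero]
      · have h2 : (t * r) • Δ.rayGen ρ = (1 : ℝ) • Δ.rayGen ρ := by
          rw [mul_smul, ← hxe, ← hye, one_smul]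
        have h3 := smul_left_injective ℝ hz h2
        have h4 : r = 1 := by
          have h5 : t * r = 1 := h3
          nlinarith
        rw [hxe, h4, one_smul]
    · rw [h1, zero_smul] at hye
      rw [hxe, hye, smul_zero]
  · rw [h0, zero_smul] at hxe
    rw [hxe, smul_zero] at hye
    rw [hxe, hye]

/-- The map `c : M → ℤ^{Σ_1}`, `u ↦ (u(ρ_N))_ρ`. -/
noncomputable def charMap : dualLattice N →+ (Δ.Ray → ℤ) :=
  AddMonoidHom.mk' (fun u ρ => (u.2 (Δ.rayGen ρ) (Δ.rayGen_spec ρ).1).choose) (by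
    intro u w
    funext ρ
    have h1 := (u.2 (Δ.rayGen ρ) (Δ.rayGen_spec ρ).1).choose_spec
    have h2 := (w.2 (Δ.rayGen ρ) (Δ.rayGen_spec ρ).1).choose_spec
    have h3 := ((u + w).2 (Δ.rayGen ρ) (Δ.rayGen_spec ρ).1).choose_spec
    have h4 : (u + w).1 (Δ.rayGen ρ) = u.1 (Δ.rayGen ρ) + w.1 (Δ.rayGen ρ) := rfl
    exact_mod_cast h3.symm.trans (h4.trans (congrArg₂ (· + ·) h1 h2)))

theorem charMap_spec (u : dualLattice N) (ρ : Δ.Ray) :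
    (Δ.charMap u ρ : ℝ) = u.1 (Δ.rayGen ρ) :=
  ((u.2 (Δ.rayGen ρ) (Δ.rayGen_spec ρ).1).choose_spec).symm

/-- The group `A`, the cokernel of `c`. -/
abbrev A : Type v := (Δ.Ray → ℤ) ⧸ Δ.charMap.range

noncomputable instance : DecidableEq Δ.A := Classical.decEq _

/-- The map `a : ℤ^{Σ_1} → A`. -/
noncomputable abbrev toA : (Δ.Ray → ℤ) →+ Δ.A := QuotientAddGroup.mk' Δ.charMap.range

open Classical in
/-- The class `α_ρ = a(δ_ρ)` of a ray. -/
noncomputable def rayClass (ρ : Δ.Ray) : Δ.A := Δ.toA (Pi.single ρ 1)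

theorem weight_rayClass (s : Δ.Ray →₀ ℕ) :
    Finsupp.weight Δ.rayClass s = Δ.toA (fun ρ => (s ρ : ℤ)) := by
  classical
  rw [Finsupp.weight_apply, Finsupp.sum_fintype _ _ (by simp)]
  have : (fun ρ => (s ρ : ℤ)) = ∑ ρ, s ρ • (Pi.single ρ 1 : Δ.Ray → ℤ) := by
    funext ρ
    simp [Finset.sum_apply, Pi.single_apply]
  rw [this, map_sum]
  refine Finset.sum_congr rfl fun ρ _ => ?_
  rw [map_nsmul]
  rfl

end Combinatorics

section Cox

variable {V : Type v} [AddCommGroup V] [Module ℝ V] [FiniteDimensional ℝ V] {N : AddSubgroup V}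
  [IsZStructure N] (Δ : Fan N) (R : Type u) [CommRing R]

/-- The Cox ring `S = R[(Z_ρ)_ρ]`. -/
abbrev Cox : Type (max u v) := MvPolynomial Δ.Ray R

/-- The `A`-grading of `S` with `deg Z_ρ = α_ρ`. -/
noncomputable def coxGrading (α : Δ.A) : Submodule R (Δ.Cox R) :=
  MvPolynomial.weightedHomogeneousSubmodule R Δ.rayClass α

noncomputable instance : GradedAlgebra (Δ.coxGrading R) :=
  MvPolynomial.weightedGradedAlgebra R Δ.rayClass

open Classical in
/-- The monomial `Ẑ_σ`, the product of all `Z_ρ` with `ρ ∉ σ_1`. -/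
noncomputable def hatZ (σ : Δ.Cone) : Δ.Cox R :=
  ∏ ρ with ¬ Δ.IsRayOf ρ σ, MvPolynomial.X ρ

/-- The ideal `I` of `S` generated by the monomials `Ẑ_σ`. -/
noncomputable def irrelevantIdeal : Ideal (Δ.Cox R) :=
  Ideal.span (Set.range (Δ.hatZ R))

/-- The ring `S_(σ)`, the degree-zero component of `S` localized at `Ẑ_σ`. -/
abbrev degZero (σ : Δ.Cone) : Type (max u v) :=
  HomogeneousLocalization.Away (Δ.coxGrading R) (Δ.hatZ R σ)

open Classical in
/-- The product of the `Z_ρ` with `ρ ∈ σ_1` and `ρ ∉ τ_1`. -/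
noncomputable def relZ (τ σ : Δ.Cone) : Δ.Cox R :=
  ∏ ρ with Δ.IsRayOf ρ σ ∧ ¬ Δ.IsRayOf ρ τ, MvPolynomial.X ρ

theorem prod_X_eq (s : Finset Δ.Ray) :
    ∏ ρ ∈ s, (MvPolynomial.X ρ : Δ.Cox R) =
      MvPolynomial.monomial (∑ ρ ∈ s, Finsupp.single ρ 1) 1 := by
  rw [MvPolynomial.monomial_sum_one]
  rfl

open Classical in
theorem sum_single_apply (s : Finset Δ.Ray) (ρ : Δ.Ray) :
    (∑ ρ' ∈ s, Finsupp.single ρ' 1 : Δ.Ray →₀ ℕ) ρ = if ρ ∈ s then 1 else 0 := by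
  rw [Finsupp.finsetSum_apply]
  simp [Finsupp.single_apply]

theorem monomial_mem {s : Δ.Ray →₀ ℕ} {α : Δ.A} (h : Δ.toA (fun ρ => (s ρ : ℤ)) = α) :
    MvPolynomial.monomial s (1 : R) ∈ Δ.coxGrading R α :=
  MvPolynomial.isWeightedHomogeneous_monomial _ _ _ ((Δ.weight_rayClass s).trans h)

/-- The degree of `Ẑ_σ`. -/
noncomputable def hatDeg (σ : Δ.Cone) : Δ.A :=
  Δ.toA (open Classical in fun ρ => if Δ.IsRayOf ρ σ then 0 else 1)

/-- The degree of the quotient of `Ẑ_τ` by `Ẑ_σ`. -/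
noncomputable def relDeg (τ σ : Δ.Cone) : Δ.A :=
  Δ.toA (open Classical in fun ρ => if Δ.IsRayOf ρ σ ∧ ¬ Δ.IsRayOf ρ τ then 1 else 0)

theorem hatZ_mem (σ : Δ.Cone) : Δ.hatZ R σ ∈ Δ.coxGrading R (Δ.hatDeg σ) := by
  classical
  rw [hatZ, prod_X_eq]
  refine Δ.monomial_mem R ?_
  rw [hatDeg]
  congr 1
  funext ρ
  rw [sum_single_apply]
  simp

theorem relZ_mem (τ σ : Δ.Cone) : Δ.relZ R τ σ ∈ Δ.coxGrading R (Δ.relDeg τ σ) := by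
  classical
  rw [relZ, prod_X_eq]
  refine Δ.monomial_mem R ?_
  rw [relDeg]
  congr 1
  funext ρ
  rw [sum_single_apply]
  simp

theorem hatZ_eq_mul_relZ {τ σ : Δ.Cone} (h : τ ≤ σ) :
    Δ.hatZ R τ = Δ.hatZ R σ * Δ.relZ R τ σ := by
  classical
  rw [hatZ, hatZ, relZ, ← Finset.prod_union]
  · congr 1
    ext ρ
    simp only [Finset.mem_filter, Finset.mem_univ, true_and, Finset.mem_union]
    have : Δ.IsRayOf ρ τ → Δ.IsRayOf ρ σ := fun h' => le_trans h' h
    tauto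
  · rw [Finset.disjoint_filter]
    tauto

theorem relZ_self (σ : Δ.Cone) : Δ.relZ R σ σ = 1 := by
  classical
  rw [relZ, Finset.prod_eq_one]
  intro ρ hρ
  simp at hρ

theorem relZ_mul {τ σ ω : Δ.Cone} (h : τ ≤ σ) (h' : σ ≤ ω) :
    Δ.relZ R τ ω = Δ.relZ R σ ω * Δ.relZ R τ σ := by
  classical
  rw [relZ, relZ, relZ, ← Finset.prod_union]
  · congr 1
    ext ρ
    simp only [Finset.mem_filter, Finset.mem_univ, true_and, Finset.mem_union]
    have h1 : Δ.IsRayOf ρ τ → Δ.IsRayOf ρ σ := fun h'' => le_trans h'' h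
    have h2 : Δ.IsRayOf ρ σ → Δ.IsRayOf ρ ω := fun h'' => le_trans h'' h'
    tauto
  · rw [Finset.disjoint_filter]
    tauto

/-- The canonical morphism `S_(σ) → S_(τ)` for a face `τ` of `σ`. -/
noncomputable def degZeroMap {τ σ : Δ.Cone} (h : τ ≤ σ) : Δ.degZero R σ →+* Δ.degZero R τ :=
  HomogeneousLocalization.awayMap (Δ.coxGrading R) (Δ.relZ_mem R τ σ) (Δ.hatZ_eq_mul_relZ R h)

theorem degZeroMap_self (σ : Δ.Cone) : Δ.degZeroMap R (le_refl σ) = RingHom.id _ := by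
  have h0 : Δ.relZ R σ σ ∈ Δ.coxGrading R 0 := by
    rw [relZ_self]; exact SetLike.one_mem_graded _
  exact awayMap_self (Δ.coxGrading R) (Δ.hatZ_mem R σ) h0 (Δ.hatZ_eq_mul_relZ R le_rfl) (Δ.relZ_self R σ)

theorem degZeroMap_comp {τ σ ω : Δ.Cone} (h : τ ≤ σ) (h' : σ ≤ ω) :
    Δ.degZeroMap R (h.trans h') = (Δ.degZeroMap R h).comp (Δ.degZeroMap R h') := by
  exact awayMap_comp (Δ.coxGrading R) (Δ.hatZ_mem R ω) _ _ _ _ _ _ (Δ.relZ_mul R h h')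

/-- The inductive system `σ ↦ Y_σ(R) = Spec S_(σ)` of schemes over the fan. -/
noncomputable def coxDiagram : Δ.Cone ⥤ Scheme.{max u v} where
  obj σ := Spec (CommRingCat.of (Δ.degZero R σ))
  map f := Spec.map (CommRingCat.ofHom (Δ.degZeroMap R (leOfHom f)))
  map_id σ := by
    rw [← Spec.map_id]
    congr 1
    ext1
    exact Δ.degZeroMap_self R σ
  map_comp f g := by
    rw [← Spec.map_comp]
    congr 1
    ext1
    exact Δ.degZeroMap_comp R (leOfHom f) (leOfHom g)

/-- The exponent of the numerator, over the denominator `Ẑ_σ ^ K`, of the monomial of degree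
zero with exponent `c(u)`. -/
noncomputable def faceExp (σ : Δ.Cone) (u : dualLattice N) (K : ℕ) : Δ.Ray →₀ ℕ :=
  Finsupp.equivFunOnFinite.symm
    (open Classical in fun ρ => (Δ.charMap u ρ + if Δ.IsRayOf ρ σ then 0 else (K : ℤ)).toNat)

theorem charMap_nonneg {σ : Δ.Cone} {u : dualLattice N} (hu : ∀ x ∈ σ.1, 0 ≤ u.1 x)
    {ρ : Δ.Ray} (hρ : Δ.IsRayOf ρ σ) : 0 ≤ Δ.charMap u ρ := by
  have h1 := hu (Δ.rayGen ρ)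
    (hρ (((Δ.rayGen_spec ρ).2.1 _).2 ⟨1, zero_le_one, (one_smul _ _).symm⟩))
  rw [← charMap_spec] at h1
  exact_mod_cast h1

theorem charMap_eq_zero_iff {τ σ : Δ.Cone} {u : dualLattice N} (hu : CutsOut u.1 τ.1 σ.1)
    {ρ : Δ.Ray} (hρ : Δ.IsRayOf ρ σ) : Δ.charMap u ρ = 0 ↔ Δ.IsRayOf ρ τ := by
  have hmem : Δ.rayGen ρ ∈ ρ.1.1 :=
    ((Δ.rayGen_spec ρ).2.1 _).2 ⟨1, zero_le_one, (one_smul _ _).symm⟩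
  have h0 : Δ.charMap u ρ = 0 ↔ u.1 (Δ.rayGen ρ) = 0 := by
    rw [← charMap_spec]; norm_cast
  rw [h0]
  constructor
  · intro h x hx
    obtain ⟨r, hr, rfl⟩ := ((Δ.rayGen_spec ρ).2.1 _).1 hx
    exact PointedCone.smul_mem _ hr ((hu.2 _).2 ⟨hρ hmem, h⟩)
  · intro h
    exact ((hu.2 _).1 (h hmem)).2

theorem faceExp_apply {σ : Δ.Cone} {u : dualLattice N} (hu : ∀ x ∈ σ.1, 0 ≤ u.1 x) {K : ℕ}
    (hK : ∀ ρ, |Δ.charMap u ρ| ≤ K) (ρ : Δ.Ray) :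
    (Δ.faceExp σ u K ρ : ℤ) =
      Δ.charMap u ρ + (open Classical in if Δ.IsRayOf ρ σ then 0 else (K : ℤ)) := by
  classical
  have : (Δ.faceExp σ u K ρ) = (Δ.charMap u ρ + if Δ.IsRayOf ρ σ then 0 else (K : ℤ)).toNat := by
    simp only [faceExp, Finsupp.equivFunOnFinite_symm_apply_apply]
  rw [this, Int.toNat_of_nonneg]
  · split_ifs with h
    · have := Δ.charMap_nonneg hu h
      lia
    · have := (abs_le.mp (hK ρ)).1
      lia

theorem faceNum_mem {σ : Δ.Cone} {u : dualLattice N} (hu : ∀ x ∈ σ.1, 0 ≤ u.1 x) {K : ℕ}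
    (hK : ∀ ρ, |Δ.charMap u ρ| ≤ K) :
    MvPolynomial.monomial (Δ.faceExp σ u K) (1 : R) ∈ Δ.coxGrading R (K • Δ.hatDeg σ) := by
  classical
  refine Δ.monomial_mem R ?_
  have : (fun ρ => (Δ.faceExp σ u K ρ : ℤ)) =
      Δ.charMap u + K • (fun ρ => if Δ.IsRayOf ρ σ then 0 else 1) := by
    funext ρ
    rw [Δ.faceExp_apply hu hK]
    simp
  rw [this, map_add, map_nsmul]
  have h0 : Δ.toA (Δ.charMap u) = 0 := (QuotientAddGroup.eq_zero_iff _).2 ⟨u, rfl⟩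
  rw [h0, zero_add]
  rfl

/-- The element of `S_(σ)` given by the monomial with exponent `c(u)`. -/
noncomputable def faceElt {σ : Δ.Cone} {u : dualLattice N} (hu : ∀ x ∈ σ.1, 0 ≤ u.1 x) {K : ℕ}
    (hK : ∀ ρ, |Δ.charMap u ρ| ≤ K) : Δ.degZero R σ :=
  HomogeneousLocalization.Away.mk (Δ.coxGrading R) (Δ.hatZ_mem R σ) K
    (MvPolynomial.monomial (Δ.faceExp σ u K) (1 : R)) (Δ.faceNum_mem R hu hK)

theorem faceElt_isLocalization {τ σ : Δ.Cone} (h : τ ≤ σ) {u : dualLattice N}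
    (hu : CutsOut u.1 τ.1 σ.1) {K : ℕ} (hK : ∀ ρ, |Δ.charMap u ρ| ≤ K) :
    letI := (Δ.degZeroMap R h).toAlgebra
    IsLocalization.Away (Δ.faceElt R hu.1 hK) (Δ.degZero R τ) := by
  classical
  have hexp := Δ.faceExp_apply hu.1 hK
  let r : Δ.Ray →₀ ℕ := ∑ ρ with Δ.IsRayOf ρ σ ∧ ¬ Δ.IsRayOf ρ τ, Finsupp.single ρ 1
  have hr : ∀ ρ, r ρ = if Δ.IsRayOf ρ σ ∧ ¬ Δ.IsRayOf ρ τ then 1 else 0 := fun ρ => by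
    simp only [r, sum_single_apply]
    simp
  let o : Δ.Ray →₀ ℕ := ∑ ρ with ¬ Δ.IsRayOf ρ τ, Finsupp.single ρ 1
  have ho : ∀ ρ, o ρ = if Δ.IsRayOf ρ τ then 0 else 1 := fun ρ => by
    simp only [o, sum_single_apply]
    simp
  have hle1 : r ≤ Δ.faceExp σ u K := by
    intro ρ
    rw [hr]
    split_ifs with h1
    · have h2 := hexp ρ
      have h3 := Δ.charMap_nonneg hu.1 h1.1
      have h4 := mt (Δ.charMap_eq_zero_iff hu h1.1).1 h1.2
      lia
    · exact Nat.zero_le _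
  have hle2 : Δ.faceExp σ u K ≤ (2 * K) • o := by
    intro ρ
    rw [Finsupp.smul_apply, ho, smul_eq_mul]
    have h2 := hexp ρ
    have h3 := abs_le.mp (hK ρ)
    by_cases h1 : Δ.IsRayOf ρ τ
    · have h4 : Δ.IsRayOf ρ σ := le_trans h1 h
      have h5 := (Δ.charMap_eq_zero_iff hu h4).2 h1
      rw [if_pos h4, h5] at h2
      rw [if_pos h1]
      lia
    · rw [if_neg h1]
      split_ifs at h2 <;> lia
  have hdeg : Δ.hatDeg σ + Δ.relDeg τ σ = Δ.hatDeg τ := by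
    rw [hatDeg, relDeg, hatDeg, ← map_add]
    congr 1
    funext ρ
    simp only [Pi.add_apply]
    have : Δ.IsRayOf ρ τ → Δ.IsRayOf ρ σ := fun h' => le_trans h' h
    by_cases h1 : Δ.IsRayOf ρ τ <;> by_cases h2 : Δ.IsRayOf ρ σ <;> simp_all
  have hKdeg : Δ.toA (fun ρ => (Δ.faceExp σ u K ρ : ℤ)) = K • Δ.hatDeg σ := by
    have : (fun ρ => (Δ.faceExp σ u K ρ : ℤ)) =
        Δ.charMap u + K • (fun ρ => if Δ.IsRayOf ρ σ then 0 else 1) := by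
      funext ρ
      rw [Δ.faceExp_apply hu.1 hK]
      simp
    rw [this, map_add, map_nsmul]
    have h0 : Δ.toA (Δ.charMap u) = 0 := (QuotientAddGroup.eq_zero_iff _).2 ⟨u, rfl⟩
    rw [h0, zero_add]
    rfl
  refine away_isLocalization (Δ.coxGrading R) (Δ.hatZ_mem R σ) (Δ.relZ_mem R τ σ)
    (Δ.hatZ_eq_mul_relZ R h) K (2 * K) (Δ.faceNum_mem R hu.1 hK)
    (a' := MvPolynomial.monomial (Δ.faceExp σ u K - r) 1)
    (b := MvPolynomial.monomial ((2 * K) • o - Δ.faceExp σ u K) 1) ?_ ?_ ?_ ?_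
  · refine Δ.monomial_mem R ?_
    rw [← hKdeg, relDeg, ← map_sub]
    congr 1
    funext ρ
    have h1 := hle1 ρ
    have h2 := hr ρ
    rw [Finsupp.tsub_apply, Nat.cast_sub h1, h2, Pi.sub_apply]
    simp
  · refine Δ.monomial_mem R ?_
    rw [← hKdeg, hdeg, hatDeg, ← map_nsmul, ← map_sub]
    congr 1
    funext ρ
    have h1 := hle2 ρ
    rw [Finsupp.tsub_apply, Nat.cast_sub h1, Finsupp.smul_apply, ho, Pi.sub_apply, Pi.smul_apply]
    simp
  · rw [relZ, prod_X_eq, MvPolynomial.monomial_mul, mul_one]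
    congr 2
    exact (tsub_add_cancel_of_le hle1).symm
  · rw [hatZ, prod_X_eq, MvPolynomial.monomial_mul, mul_one, MvPolynomial.monomial_pow, one_pow]
    congr 2
    exact add_tsub_cancel_of_le hle2

theorem exists_bound (u : dualLattice N) : ∃ K : ℕ, ∀ ρ, |Δ.charMap u ρ| ≤ K := by
  refine ⟨∑ ρ, (Δ.charMap u ρ).natAbs, fun ρ => ?_⟩
  have := Finset.single_le_sum (f := fun ρ => (Δ.charMap u ρ).natAbs)
    (fun _ _ => Nat.zero_le _) (Finset.mem_univ ρ)
  rw [Int.abs_eq_natAbs]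
  exact_mod_cast this

instance isOpenImmersion_coxDiagram_map {τ σ : Δ.Cone} (f : τ ⟶ σ) :
    IsOpenImmersion ((Δ.coxDiagram R).map f) := by
  obtain ⟨u, huM, hu⟩ := (Δ.le_iff_isFace τ σ).1 (leOfHom f)
  obtain ⟨K, hK⟩ := Δ.exists_bound ⟨u, huM⟩
  let _ := (Δ.degZeroMap R (leOfHom f)).toAlgebra
  have := Δ.faceElt_isLocalization R (leOfHom f) (u := ⟨u, huM⟩) hu hK
  exact IsOpenImmersion.of_isLocalization (Δ.faceElt R (u := ⟨u, huM⟩) hu.1 hK)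

theorem range_coxDiagram_map {τ σ : Δ.Cone} (h : τ ≤ σ) {u : dualLattice N}
    (hu : CutsOut u.1 τ.1 σ.1) {K : ℕ} (hK : ∀ ρ, |Δ.charMap u ρ| ≤ K) :
    Set.range (PrimeSpectrum.comap (Δ.degZeroMap R h)) =
      PrimeSpectrum.basicOpen (Δ.faceElt R hu.1 hK) := by
  let _ := (Δ.degZeroMap R h).toAlgebra
  have := Δ.faceElt_isLocalization R h hu hK
  exact PrimeSpectrum.localization_away_comap_range (Δ.degZero R τ) (Δ.faceElt R hu.1 hK)

theorem faceElt_mul {σ : Δ.Cone} {u w : dualLattice N} (hu : ∀ x ∈ σ.1, 0 ≤ u.1 x)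
    (hw : ∀ x ∈ σ.1, 0 ≤ w.1 x) (huw : ∀ x ∈ σ.1, 0 ≤ (u + w).1 x) {K L : ℕ}
    (hK : ∀ ρ, |Δ.charMap u ρ| ≤ K) (hL : ∀ ρ, |Δ.charMap w ρ| ≤ L)
    (hKL : ∀ ρ, |Δ.charMap (u + w) ρ| ≤ (K + L : ℕ)) :
    Δ.faceElt R huw hKL = Δ.faceElt R hu hK * Δ.faceElt R hw hL := by
  classical
  apply HomogeneousLocalization.val_injective
  simp only [faceElt, HomogeneousLocalization.val_mul, HomogeneousLocalization.Away.val_mk]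
  rw [Localization.mk_mul, MvPolynomial.monomial_mul, mul_one]
  have h : Δ.faceExp σ (u + w) (K + L) = Δ.faceExp σ u K + Δ.faceExp σ w L := by
    ext ρ
    have h1 := Δ.faceExp_apply hu hK ρ
    have h2 := Δ.faceExp_apply hw hL ρ
    have h3 := Δ.faceExp_apply huw hKL ρ
    rw [map_add, Pi.add_apply] at h3
    rw [Finsupp.add_apply]
    split_ifs at h1 h2 h3 <;> lia
  rw [h]
  congr 1
  ext
  simp [pow_add]

theorem degZeroMap_comap_injective {τ σ : Δ.Cone} (h : τ ≤ σ) :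
    Function.Injective (PrimeSpectrum.comap (Δ.degZeroMap R h)) := by
  obtain ⟨u, huM, hu⟩ := (Δ.le_iff_isFace τ σ).1 h
  obtain ⟨K, hK⟩ := Δ.exists_bound ⟨u, huM⟩
  let _ := (Δ.degZeroMap R h).toAlgebra
  have := Δ.faceElt_isLocalization R h (u := ⟨u, huM⟩) hu hK
  exact PrimeSpectrum.localization_comap_injective (Δ.degZero R τ)
    (Submonoid.powers (Δ.faceElt R (u := ⟨u, huM⟩) hu.1 hK))

theorem exists_comap_eq {τ₁ τ₂ σ : Δ.Cone} (h₁ : τ₁ ≤ σ) (h₂ : τ₂ ≤ σ)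
    (x₁ : PrimeSpectrum (Δ.degZero R τ₁)) (x₂ : PrimeSpectrum (Δ.degZero R τ₂))
    (hx : PrimeSpectrum.comap (Δ.degZeroMap R h₁) x₁ =
      PrimeSpectrum.comap (Δ.degZeroMap R h₂) x₂) :
    ∃ (ω : Δ.Cone) (k₁ : ω ≤ τ₁) (k₂ : ω ≤ τ₂) (z : PrimeSpectrum (Δ.degZero R ω)),
      PrimeSpectrum.comap (Δ.degZeroMap R k₁) z = x₁ ∧
        PrimeSpectrum.comap (Δ.degZeroMap R k₂) z = x₂ := by
  obtain ⟨u, huM, hu⟩ := (Δ.le_iff_isFace τ₁ σ).1 h₁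
  obtain ⟨w, hwM, hw⟩ := (Δ.le_iff_isFace τ₂ σ).1 h₂
  obtain ⟨K, hK⟩ := Δ.exists_bound ⟨u, huM⟩
  obtain ⟨L, hL⟩ := Δ.exists_bound ⟨w, hwM⟩
  let ω : Δ.Cone := ⟨τ₁.1 ⊓ τ₂.1,
    Δ.face_mem τ₁.1 τ₁.2 _ (Δ.inter_face τ₁.1 τ₁.2 τ₂.1 τ₂.2).1⟩
  have k₁ : ω ≤ τ₁ := inf_le_left (a := τ₁.1) (b := τ₂.1)
  have k₂ : ω ≤ τ₂ := inf_le_right (a := τ₁.1) (b := τ₂.1)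
  let m : dualLattice N := ⟨u, huM⟩ + ⟨w, hwM⟩
  have hm : CutsOut m.1 ω.1 σ.1 := by
    have hadd : ∀ x, m.1 x = u x + w x := fun x => rfl
    refine ⟨fun x hx => ?_, fun x => ?_⟩
    · rw [hadd]
      exact add_nonneg (hu.1 x hx) (hw.1 x hx)
    · rw [hadd]
      constructor
      · intro hxω
        have a₁ := (hu.2 x).1 (k₁ hxω)
        have a₂ := (hw.2 x).1 (k₂ hxω)
        exact ⟨a₁.1, by rw [a₁.2, a₂.2, add_zero]⟩
      · rintro ⟨hxσ, h0⟩
        have a₁ := hu.1 x hxσ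
        have a₂ := hw.1 x hxσ
        exact ⟨(hu.2 x).2 ⟨hxσ, by linarith⟩, (hw.2 x).2 ⟨hxσ, by linarith⟩⟩
  have hKL : ∀ ρ, |Δ.charMap m ρ| ≤ (K + L : ℕ) := by
    intro ρ
    rw [map_add, Pi.add_apply]
    have := abs_add_le (Δ.charMap ⟨u, huM⟩ ρ) (Δ.charMap ⟨w, hwM⟩ ρ)
    have b₁ := hK ρ
    have b₂ := hL ρ
    push_cast
    linarith
  have r₁ := Δ.range_coxDiagram_map R h₁ (u := ⟨u, huM⟩) hu hK
  have r₂ := Δ.range_coxDiagram_map R h₂ (u := ⟨w, hwM⟩) hw hL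
  have r := Δ.range_coxDiagram_map R (k₁.trans h₁) hm hKL
  rw [Δ.faceElt_mul R (u := ⟨u, huM⟩) (w := ⟨w, hwM⟩) hu.1 hw.1 hm.1 hK hL hKL,
    PrimeSpectrum.basicOpen_mul, TopologicalSpace.Opens.coe_inf, ← r₁, ← r₂] at r
  have hmem : PrimeSpectrum.comap (Δ.degZeroMap R h₁) x₁ ∈
      Set.range (PrimeSpectrum.comap (Δ.degZeroMap R (k₁.trans h₁))) := by
    rw [r]
    exact ⟨⟨x₁, rfl⟩, ⟨x₂, hx.symm⟩⟩
  obtain ⟨z, hz⟩ := hmem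
  refine ⟨ω, k₁, k₂, z, ?_, ?_⟩
  · apply Δ.degZeroMap_comap_injective R h₁
    rw [← hz, Δ.degZeroMap_comp R k₁ h₁]
    rfl
  · apply Δ.degZeroMap_comap_injective R h₂
    rw [← hx, ← hz]
    have : Δ.degZeroMap R (k₁.trans h₁) = Δ.degZeroMap R (k₂.trans h₂) := rfl
    rw [this, Δ.degZeroMap_comp R k₂ h₂]
    rfl

instance isLocallyDirected_coxDiagram :
    (Δ.coxDiagram R ⋙ Scheme.forget).IsLocallyDirected where
  cond {_ _ _} f₁ f₂ x₁ x₂ hx := by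
    obtain ⟨ω, k₁, k₂, z, hz₁, hz₂⟩ :=
      Δ.exists_comap_eq R (leOfHom f₁) (leOfHom f₂) x₁ x₂ hx
    exact ⟨ω, homOfLE k₁, homOfLE k₂, z, hz₁, hz₂⟩

/-- The Cox scheme `Y_Σ(R)`, the inductive limit of the schemes `Y_σ(R)`. -/
noncomputable def coxScheme : Scheme.{max u v} := colimit (Δ.coxDiagram R)

/-- The canonical open immersion `Y_σ(R) ⟶ Y_Σ(R)`. -/
noncomputable def coxChart (σ : Δ.Cone) :
    Spec (CommRingCat.of (Δ.degZero R σ)) ⟶ Δ.coxScheme R :=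
  colimit.ι (Δ.coxDiagram R) σ

instance (σ : Δ.Cone) : IsOpenImmersion (Δ.coxChart R σ) :=
  inferInstanceAs (IsOpenImmersion (colimit.ι (Δ.coxDiagram R) σ))

end Cox

end Fan

end Toric

namespace Toric

namespace Fan

section Restricted

variable {V : Type v} [AddCommGroup V] [Module ℝ V] [FiniteDimensional ℝ V] {N : AddSubgroup V}
  [IsZStructure N] (Δ : Fan N) (R : Type u) [CommRing R] (B : AddSubgroup Δ.A)

/-- The `B`-restricted Cox ring `S_B`, the sum of the components `S_α` with `α ∈ B`: the
polynomials all of whose monomials have degree in `B`. -/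
noncomputable def coxRestrict : Subalgebra R (Δ.Cox R) where
  carrier := {f | ∀ s, f.coeff s ≠ 0 → Finsupp.weight Δ.rayClass s ∈ B}
  mul_mem' := by
    classical
    intro f g hf hg s hs
    rw [MvPolynomial.coeff_mul] at hs
    obtain ⟨⟨p, q⟩, hpq, h⟩ := Finset.exists_ne_zero_of_sum_ne_zero hs
    replace hpq : p + q = s := Finset.HasAntidiagonal.mem_antidiagonal.mp hpq
    simp only at h
    rw [← hpq, map_add]
    exact add_mem (hf p (left_ne_zero_of_mul h)) (hg q (right_ne_zero_of_mul h))
  add_mem' := by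
    intro f g hf hg s hs
    rw [MvPolynomial.coeff_add] at hs
    by_cases h : f.coeff s = 0
    · exact hg s (by rwa [h, zero_add] at hs)
    · exact hf s h
  algebraMap_mem' := by
    classical
    intro r s hs
    rw [MvPolynomial.algebraMap_eq, MvPolynomial.coeff_C] at hs
    split_ifs at hs with h
    · rw [← h, map_zero]; exact zero_mem B
    · exact absurd rfl hs

theorem mem_coxRestrict_of_mem {α : Δ.A} (hα : α ∈ B) {f : Δ.Cox R}
    (hf : f ∈ Δ.coxGrading R α) : f ∈ Δ.coxRestrict R B := fun s hs => by
  have h : Finsupp.weight Δ.rayClass s = α := hf hs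
  rwa [h]

/-- The `B`-grading of `S_B`. -/
noncomputable def restrictGrading (β : B) : Submodule R (Δ.coxRestrict R B) :=
  (Δ.coxGrading R β.1).comap (Δ.coxRestrict R B).val.toLinearMap

theorem mem_restrictGrading {β : B} {f : Δ.coxRestrict R B} :
    f ∈ Δ.restrictGrading R B β ↔ f.1 ∈ Δ.coxGrading R β.1 := Iff.rfl

instance restrictGrading_gradedMonoid : SetLike.GradedMonoid (Δ.restrictGrading R B) where
  one_mem := SetLike.one_mem_graded (Δ.coxGrading R)
  mul_mem _ _ _ _ hf hg := SetLike.mul_mem_graded (A := Δ.coxGrading R) hf hg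

theorem coeff_coeAddMonoidHom (x : DirectSum B fun β => Δ.restrictGrading R B β)
    (s : Δ.Ray →₀ ℕ) (hs : Finsupp.weight Δ.rayClass s ∈ B) :
    (DirectSum.coeAddMonoidHom (Δ.restrictGrading R B) x).1.coeff s =
      (x ⟨_, hs⟩).1.1.coeff s := by
  classical
  induction x using DirectSum.induction_on with
  | zero => simp
  | of β f =>
    rw [DirectSum.coeAddMonoidHom_of, DirectSum.coe_of_apply]
    split_ifs with h
    · rfl
    · by_contra hne
      apply h
      have h1 : Finsupp.weight Δ.rayClass s = β.1 := f.2 (by simpa using hne)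
      exact Subtype.ext h1.symm
  | add x y hx hy =>
    rw [map_add, DirectSum.add_apply]
    simp only [Subalgebra.coe_add, Submodule.coe_add, MvPolynomial.coeff_add, hx, hy]

open Classical in
/-- The decomposition of an element of `S_B` into its homogeneous components. -/
noncomputable def restrictDecompose (f : Δ.coxRestrict R B) :
    DirectSum B fun β => Δ.restrictGrading R B β :=
  DirectSum.mk (fun β => Δ.restrictGrading R B β)
    ((f.1.support.image (Finsupp.weight Δ.rayClass)).subtype (· ∈ B))
    fun β => ⟨⟨MvPolynomial.weightedHomogeneousComponent Δ.rayClass β.1.1 f.1,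
      Δ.mem_coxRestrict_of_mem R B β.1.2
        (MvPolynomial.weightedHomogeneousComponent_mem Δ.rayClass f.1 β.1.1)⟩,
      MvPolynomial.weightedHomogeneousComponent_mem Δ.rayClass f.1 β.1.1⟩

theorem restrictDecompose_apply (f : Δ.coxRestrict R B) (β : B) :
    (Δ.restrictDecompose R B f β).1.1 =
      MvPolynomial.weightedHomogeneousComponent Δ.rayClass β.1 f.1 := by
  classical
  by_cases h : β ∈ (f.1.support.image (Finsupp.weight Δ.rayClass)).subtype (· ∈ B)
  · rw [restrictDecompose, DirectSum.mk_apply_of_mem h]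
  · rw [restrictDecompose, DirectSum.mk_apply_of_notMem h,
      MvPolynomial.weightedHomogeneousComponent_eq_zero_of_notMem]
    · rfl
    · rwa [Finset.mem_subtype] at h

noncomputable instance : GradedAlgebra (Δ.restrictGrading R B) where
  decompose' := Δ.restrictDecompose R B
  left_inv f := by
    classical
    apply Subtype.ext
    ext s
    by_cases hs : Finsupp.weight Δ.rayClass s ∈ B
    · rw [coeff_coeAddMonoidHom _ _ _ _ _ hs, restrictDecompose_apply,
        MvPolynomial.coeff_weightedHomogeneousComponent, if_pos rfl]
    · rw [not_not.mp (mt ((DirectSum.coeAddMonoidHom (Δ.restrictGrading R B)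
        (Δ.restrictDecompose R B f)).2 s) hs), not_not.mp (mt (f.2 s) hs)]
  right_inv x := by
    classical
    refine DFinsupp.ext fun β => ?_
    apply Subtype.ext
    apply Subtype.ext
    rw [restrictDecompose_apply]
    ext s
    rw [MvPolynomial.coeff_weightedHomogeneousComponent]
    split_ifs with h
    · have hs : Finsupp.weight Δ.rayClass s ∈ B := h ▸ β.2
      rw [coeff_coeAddMonoidHom _ _ _ _ _ hs]
      have : (⟨_, hs⟩ : B) = β := Subtype.ext h
      rw [this]
    · by_contra hne
      exact h ((x β).2 (fun h' => hne h'.symm))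

/-- The `B`-restricted irrelevant ideal `I_B = I ∩ S_B`. -/
noncomputable def restrictIrrelevant : Ideal (Δ.coxRestrict R B) :=
  (Δ.irrelevantIdeal R).comap (Δ.coxRestrict R B).val.toRingHom

/-- An ideal `𝔞` of `S_B` is `I_B`-saturated if it is the union of the `(𝔞 : I_B ^ k)`. -/
def IsSaturated (𝔞 : Ideal (Δ.coxRestrict R B)) : Prop :=
  (𝔞 : Set (Δ.coxRestrict R B)) =
    ⋃ k : ℕ, (𝔞.colon ((Δ.restrictIrrelevant R B ^ k : Ideal _) : Set (Δ.coxRestrict R B)) :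
      Set (Δ.coxRestrict R B))

/-- The set of `I_B`-saturated graded ideals of `S_B`. -/
abbrev SaturatedIdeal : Type (max u v) :=
  {𝔞 : Ideal (Δ.coxRestrict R B) //
    𝔞.IsHomogeneous (Δ.restrictGrading R B) ∧ Δ.IsSaturated R B 𝔞}

/-- For a subgroup `B` of finite index, the ideal `𝔞_(σ)` of `S_(σ)`: the degree-zero component
of the localization of the graded ideal `𝔞` of `S_B` at the powers of `Ẑ_σ` that lie in `S_B`. -/
noncomputable def locIdeal [B.FiniteIndex] (𝔞 : Ideal (Δ.coxRestrict R B)) (σ : Δ.Cone) :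
    Ideal (Δ.degZero R σ) where
  carrier := {x | ∃ k : ℕ, Δ.hatZ R σ ^ k ∈ Δ.coxRestrict R B ∧ ∃ f ∈ 𝔞,
    ∃ hf : f.1 ∈ Δ.coxGrading R (k • Δ.hatDeg σ),
      x = HomogeneousLocalization.Away.mk (Δ.coxGrading R) (Δ.hatZ_mem R σ) k f.1 hf}
  zero_mem' := by
    refine ⟨0, by rw [pow_zero]; exact one_mem _, 0, zero_mem _, zero_mem _, ?_⟩
    apply HomogeneousLocalization.val_injective
    simp [HomogeneousLocalization.Away.val_mk, Localization.mk_zero]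
  add_mem' := by
    rintro _ _ ⟨k, hk, f, hfa, hf, rfl⟩ ⟨l, hl, g, hga, hg, rfl⟩
    refine ⟨k + l, by rw [pow_add]; exact mul_mem hk hl,
      ⟨_, hl⟩ * f + ⟨_, hk⟩ * g, add_mem (𝔞.mul_mem_left _ hfa) (𝔞.mul_mem_left _ hga), ?_, ?_⟩
    · refine add_mem ?_ ?_
      · rw [add_comm k l, add_smul]
        exact SetLike.mul_mem_graded (SetLike.pow_mem_graded l (Δ.hatZ_mem R σ)) hf
      · rw [add_smul]
        exact SetLike.mul_mem_graded (SetLike.pow_mem_graded k (Δ.hatZ_mem R σ)) hg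
    · apply HomogeneousLocalization.val_injective
      simp only [HomogeneousLocalization.val_add, HomogeneousLocalization.Away.val_mk,
        Localization.add_mk]
      congr 1
      · simp only [Subalgebra.coe_add, Subalgebra.coe_mul]
        ring
      · ext
        simp [pow_add]
  smul_mem' := by
    rintro y _ ⟨k, hk, f, hfa, hf, rfl⟩
    obtain ⟨l, g, hg, rfl⟩ := HomogeneousLocalization.Away.mk_surjective _ (Δ.hatZ_mem R σ) y
    obtain ⟨i, hi⟩ : ∃ i, B.index = i + 1 :=
      Nat.exists_eq_succ_of_ne_zero AddSubgroup.FiniteIndex.index_ne_zero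
    have hB : (i * l + l) • Δ.hatDeg σ ∈ B := by
      have : i * l + l = l * B.index := by rw [hi]; ring
      rw [this, mul_smul]
      exact nsmul_mem (B.nsmul_index_mem _) l
    have hg' : Δ.hatZ R σ ^ (i * l) * g ∈ Δ.coxGrading R ((i * l + l) • Δ.hatDeg σ) := by
      rw [add_smul]
      exact SetLike.mul_mem_graded (SetLike.pow_mem_graded _ (Δ.hatZ_mem R σ)) hg
    refine ⟨(i * l + l) + k, ?_, ⟨_, Δ.mem_coxRestrict_of_mem R B hB hg'⟩ * f,
      𝔞.mul_mem_left _ hfa, ?_, ?_⟩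
    · rw [pow_add]
      exact mul_mem (Δ.mem_coxRestrict_of_mem R B hB
        (SetLike.pow_mem_graded _ (Δ.hatZ_mem R σ))) hk
    · rw [add_smul]
      exact SetLike.mul_mem_graded hg' hf
    · apply HomogeneousLocalization.val_injective
      simp only [smul_eq_mul, HomogeneousLocalization.val_mul, HomogeneousLocalization.Away.val_mk,
        Localization.mk_mul, Subalgebra.coe_mul]
      rw [Localization.mk_eq_mk_iff, Localization.r_iff_exists]
      refine ⟨1, ?_⟩
      simp only [Submonoid.coe_mul, OneMemClass.coe_one, one_mul]
      ring

/-- The quasicoherent ideal on `Y_σ(R)` associated with the ideal `𝔞_(σ)` of `S_(σ)`. -/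
noncomputable def locIdealSheaf [B.FiniteIndex] (𝔞 : Ideal (Δ.coxRestrict R B)) (σ : Δ.Cone) :
    (Spec (CommRingCat.of (Δ.degZero R σ))).IdealSheafData :=
  Scheme.IdealSheafData.ofIdealTop
    ((Δ.locIdeal R B 𝔞 σ).map (Scheme.ΓSpecIso (CommRingCat.of (Δ.degZero R σ))).inv.hom)

/-- The map `Ξ_B`: the quasicoherent ideal of those sections of the structure sheaf of `Y_Σ(R)`
whose restriction to each `Y_σ(R)` belongs to the ideal associated with `𝔞_(σ)`. -/
noncomputable def Xi [B.FiniteIndex] (𝔞 : Δ.SaturatedIdeal R B) :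
    (Δ.coxScheme R).IdealSheafData :=
  ⨅ σ : Δ.Cone, (Δ.locIdealSheaf R B 𝔞.1 σ).map (Δ.coxChart R σ)

end Restricted

section Groups

variable {V : Type v} [AddCommGroup V] [Module ℝ V] [FiniteDimensional ℝ V] {N : AddSubgroup V}
  [IsZStructure N] (Δ : Fan N)

/-- `B` is small: for every cone `σ`, it is contained in the subgroup generated by the classes
`α_ρ` with `ρ ∉ σ_1`. -/
def IsSmall (B : AddSubgroup Δ.A) : Prop :=
  B ≤ ⨅ σ : Δ.Cone, AddSubgroup.closure {α | ∃ ρ, ¬ Δ.IsRayOf ρ σ ∧ α = Δ.rayClass ρ}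

/-- The families `(m_σ)_σ` in `M` that define virtual polytopes `(m_σ + σ^∨)_σ`: the form
`m_σ - m_τ` vanishes on `τ` whenever `τ` is a face of `σ`. -/
def virtualPolytopeFamilies : AddSubgroup (Δ.Cone → dualLattice N) where
  carrier := {m | ∀ τ σ : Δ.Cone, τ ≤ σ → ∀ x ∈ τ.1, (m σ).1 x = (m τ).1 x}
  zero_mem' := fun _ _ _ _ _ => rfl
  add_mem' := fun hm hn τ σ h x hx =>
    congrArg₂ (fun a b : ℝ => a + b) (hm τ σ h x hx) (hn τ σ h x hx)
  neg_mem' := fun hm τ σ h x hx => congrArg (fun a : ℝ => -a) (hm τ σ h x hx)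

/-- The map sending `(m_σ + σ^∨)_σ` to `(m_ρ(ρ_N))_ρ`. -/
noncomputable def rayValues : (Δ.Cone → dualLattice N) →+ (Δ.Ray → ℤ) :=
  AddMonoidHom.mk' (fun m ρ => Δ.charMap (m ρ.1) ρ) (by
    intro m n
    funext ρ
    simp)

/-- The Picard group `Pic(Σ)` of the fan, as a subgroup of `A`: the group of virtual polytopes
modulo translations by elements of `M`, embedded by means of the values on the generators of the
rays. -/
noncomputable def pic : AddSubgroup Δ.A :=
  (Δ.virtualPolytopeFamilies.map Δ.rayValues).map Δ.toA

/-- The fan is simplicial: each of its cones is generated by linearly independent vectors. -/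
def IsSimplicial : Prop := ∀ σ ∈ Δ.cones, σ.IsSimplicial

end Groups

end Fan

end Toric

/-!
# Saturated graded ideals and quasicoherent ideals on a Cox scheme

The charts `Y_σ = Spec S_(σ)` are affine, and `Y_σ ×_{Y_Σ} Y_τ = Y_{σ ∩ τ}`; hence the charts are
affine morphisms, and base change for direct images of ideals shows that a quasicoherent ideal on
`Y_Σ` is the same as a family of ideals `J_σ ⊆ S_(σ)` such that `J_τ` is the extension of `J_σ` for
every face `τ` of `σ` (`Toric.Fan.IsCompatible.eq_iInf_map_iff`, `Toric.Fan.exists_isCompatible`).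
It remains to compare such families with saturated graded ideals of `S_B`.

All the rings `S_(σ)` embed into the ring of Laurent polynomials in the `Z_ρ`, as the elements of
degree zero without poles along the rays of `σ`. If `u` cuts out the face `τ` of `σ`, then `S_(τ)`
arises from `S_(σ)` by inverting the Laurent monomial with exponent `c(u)`, which is positive along
the rays of `σ` outside `τ`. Multiplying by powers of it removes poles, which yields the
compatibility of the family `𝔞_(σ)` (`Toric.Fan.isCompatible_locIdeal`).

Conversely, a compatible family `J` defines the graded ideal of those polynomials whose homogeneous
components, multiplied by a Laurent monomial such that the product has degree zero and the monomial
has no poles along the rays of `σ`, always land in `J_σ`. This ideal is saturated, and its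
localizations are the `J_σ` (`Toric.Fan.locIdeal_restrictGradedIdeal`): if `f / Ẑ_σ ^ k` lies in
`J_σ`, then, on `Y_{σ ∩ τ}`, it becomes a section of `J_τ` after multiplication by some power of the
monomial with exponent `c(u)`, where `u` cuts out `σ ∩ τ` in `τ`; and this power divides a high
power of `Ẑ_σ` up to Laurent monomials without poles along the rays of `τ`. As there are finitely
many `τ`, the numerator `f Ẑ_σ ^ m` belongs to the graded ideal for large `m`. This proves
surjectivity of `Ξ_B`.

If `B` is small, then `S_{Ẑ_σ}` contains an invertible monomial of every degree in `B`. Thus every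
homogeneous element `f` of a graded ideal `𝔞` can be moved into degree zero over every chart, and
`𝔞_(σ) ⊆ 𝔟_(σ)` for all `σ` gives `f Ẑ_σ ^ k ∈ 𝔟` for all `σ` and some `k`. Powers of the `Ẑ_σ`
generate an ideal containing a power of `I`, so that `f ∈ 𝔟` if `𝔟` is saturated
(`Toric.Fan.le_of_locIdeal_le`). This proves injectivity.

A class in `Pic(Σ)` given by `(m_σ)` is, after subtraction of `c(m_σ)`, supported on the rays not in
`σ`; hence `Pic(Σ)` is small. If the fan is simplicial, then the minimal generators of the rays of a
cone are linearly independent lattice points, hence integral forms can take arbitrary values on them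
up to a common multiple (`Toric.exists_dual_eq_mul`). So a multiple of every class lies in `Pic(Σ)`,
and the finitely generated torsion group `A / Pic(Σ)` is finite.
-/

namespace Toric

/-! ### Quasicoherent ideals and open immersions -/

section IdealSheaves

open Scheme

/-- Base change for ideal sheaves along an open immersion. -/
theorem comap_map_of_isPullback {X Y U W : Scheme.{u}} {f : X ⟶ Y} {f' : U ⟶ W} {iU : U ⟶ X}
    {iW : W ⟶ Y} [IsOpenImmersion iW] [QuasiCompact f] (H : IsPullback f' iU iW f)
    (I : X.IdealSheafData) : (I.map f).comap iW = (I.comap iU).map f' := by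
  apply IdealSheafData.ext
  funext T
  have H' := (IsPullback.of_hasPullback iU I.subschemeι).paste_horiz H
  rw [IdealSheafData.ideal_comap_of_isOpenImmersion, IdealSheafData.map,
    ← ker_ideal_of_isPullback_of_isOpenImmersion _ _ _ _ H' T, Hom.ker_comp]
  rfl

theorem ofIdealTop_comap {X Y : Scheme.{u}} [IsAffine X] [IsAffine Y] (f : X ⟶ Y)
    [IsOpenImmersion f] (I : Ideal Γ(Y, ⊤)) :
    (IdealSheafData.ofIdealTop I).comap f =
      IdealSheafData.ofIdealTop (I.map f.appTop.hom) := by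
  apply IdealSheafData.ext_of_isAffine
  rw [IdealSheafData.ideal_comap_of_isOpenImmersion]
  simp only [IdealSheafData.ofIdealTop_ideal]
  have h : ∀ K : Ideal Γ(Y, f ''ᵁ ⊤), K.comap (f.appIso ⊤).inv.hom = K.map (f.appIso ⊤).hom.hom := 
    fun K => (Ideal.map_comap_of_equiv (f.appIso ⊤).commRingCatIsoToRingEquiv).symm
  rw [h, Ideal.map_map, Ideal.map_map, ← CommRingCat.hom_comp, ← CommRingCat.hom_comp]
  congr 2
  simp [Hom.appIso_hom', Hom.appTop, Hom.app_eq_appLE]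

/-- Inclusions of quasicoherent ideals can be checked on a covering by affine open subschemes. -/
theorem le_of_comap_le {Y : Scheme.{u}} {ι : Type*} {X : ι → Scheme.{u}} [∀ i, IsAffine (X i)]
    (f : ∀ i, X i ⟶ Y) [∀ i, IsOpenImmersion (f i)] (hf : ∀ y, ∃ i x, f i x = y)
    {I J : Y.IdealSheafData} (h : ∀ i, I.comap (f i) ≤ J.comap (f i)) : I ≤ J := by
  refine IdealSheafData.le_of_iSup_eq_top
    (fun i => ⟨f i ''ᵁ ⊤, (isAffineOpen_top _).image_of_isOpenImmersion _⟩) ?_ fun i => ?_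
  · refine top_le_iff.mp fun y _ => ?_
    obtain ⟨i, x, rfl⟩ := hf y
    exact TopologicalSpace.Opens.mem_iSup.mpr ⟨i, x, trivial, rfl⟩
  · have h1 := h i ⟨⊤, isAffineOpen_top _⟩
    rw [IdealSheafData.ideal_comap_of_isOpenImmersion,
      IdealSheafData.ideal_comap_of_isOpenImmersion] at h1
    exact (Ideal.comap_le_comap_iff_of_surjective _
      ((f i).appIso ⊤).symm.commRingCatIsoToRingEquiv.surjective _ _).mp h1

theorem ext_of_comap_eq {Y : Scheme.{u}} {ι : Type*} {X : ι → Scheme.{u}} [∀ i, IsAffine (X i)]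
    (f : ∀ i, X i ⟶ Y) [∀ i, IsOpenImmersion (f i)] (hf : ∀ y, ∃ i x, f i x = y)
    {I J : Y.IdealSheafData} (h : ∀ i, I.comap (f i) = J.comap (f i)) : I = J :=
  (le_of_comap_le f hf fun i => (h i).le).antisymm (le_of_comap_le f hf fun i => (h i).ge)

end IdealSheaves

namespace Fan

/-! ### Glueing quasicoherent ideals on the Cox scheme -/

section Glue

variable {V : Type v} [AddCommGroup V] [Module ℝ V] [FiniteDimensional ℝ V] {N : AddSubgroup V}
  [IsZStructure N] (Δ : Fan N) (R : Type u) [CommRing R]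

/-- The intersection of two cones of a fan, which again belongs to the fan. -/
def inter (σ τ : Δ.Cone) : Δ.Cone :=
  ⟨σ.1 ⊓ τ.1, Δ.face_mem σ.1 σ.2 _ (Δ.inter_face σ.1 σ.2 τ.1 τ.2).1⟩

theorem inter_le_left (σ τ : Δ.Cone) : Δ.inter σ τ ≤ σ := inf_le_left (a := σ.1) (b := τ.1)

theorem inter_le_right (σ τ : Δ.Cone) : Δ.inter σ τ ≤ τ := inf_le_right (a := σ.1) (b := τ.1)

theorem le_inter {ω σ τ : Δ.Cone} (h : ω ≤ σ) (h' : ω ≤ τ) : ω ≤ Δ.inter σ τ :=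
  le_inf (α := PointedCone ℝ V) h h'

/-- The open immersion `Y_τ(R) ⟶ Y_σ(R)` for a face `τ` of `σ`. -/
noncomputable def coxFaceMap {τ σ : Δ.Cone} (h : τ ≤ σ) :
    Spec (CommRingCat.of (Δ.degZero R τ)) ⟶ Spec (CommRingCat.of (Δ.degZero R σ)) :=
  (Δ.coxDiagram R).map (homOfLE h)

instance {τ σ : Δ.Cone} (h : τ ≤ σ) : IsOpenImmersion (Δ.coxFaceMap R h) :=
  Δ.isOpenImmersion_coxDiagram_map R (homOfLE h)

theorem coxFaceMap_chart {τ σ : Δ.Cone} (h : τ ≤ σ) :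
    Δ.coxFaceMap R h ≫ Δ.coxChart R σ = Δ.coxChart R τ :=
  colimit.w (Δ.coxDiagram R) (homOfLE h)

theorem coxChart_jointly_surjective (y : Δ.coxScheme R) :
    ∃ (σ : Δ.Cone) (x : Spec (CommRingCat.of (Δ.degZero R σ))), Δ.coxChart R σ x = y := by
  exact Scheme.IsLocallyDirected.ι_jointly_surjective (Δ.coxDiagram R) y

theorem coxChart_preimage_opensRange (σ τ : Δ.Cone) :
    Δ.coxChart R σ ⁻¹ᵁ (Δ.coxChart R τ).opensRange =
      (Δ.coxFaceMap R (Δ.inter_le_left σ τ)).opensRange := by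
  ext x
  constructor
  · rintro ⟨y, hy⟩
    obtain ⟨k, f, g, z, hz, -⟩ := (Scheme.IsLocallyDirected.ι_eq_ι_iff (Δ.coxDiagram R)).1 hy.symm
    have hk := Δ.le_inter (leOfHom f) (leOfHom g)
    have e : Δ.coxFaceMap R hk ≫ Δ.coxFaceMap R (Δ.inter_le_left σ τ) = (Δ.coxDiagram R).map f :=
      ((Δ.coxDiagram R).map_comp (homOfLE hk) (homOfLE (Δ.inter_le_left σ τ))).symm
    refine ⟨Δ.coxFaceMap R hk z, Eq.trans ?_ hz⟩
    exact (Scheme.Hom.comp_apply _ _ _).symm.trans congr($e z)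
  · rintro ⟨z, rfl⟩
    refine ⟨Δ.coxFaceMap R (Δ.inter_le_right σ τ) z, ?_⟩
    rw [← Scheme.Hom.comp_apply, ← Scheme.Hom.comp_apply, coxFaceMap_chart, coxFaceMap_chart]

theorem isPullback_coxChart (σ τ : Δ.Cone) :
    IsPullback (Δ.coxFaceMap R (Δ.inter_le_right σ τ)) (Δ.coxFaceMap R (Δ.inter_le_left σ τ))
      (Δ.coxChart R τ) (Δ.coxChart R σ) :=
  IsOpenImmersion.isPullback _ _ _ _ (by rw [coxFaceMap_chart, coxFaceMap_chart])
    (Δ.coxChart_preimage_opensRange R σ τ)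

instance isAffineHom_coxChart (σ : Δ.Cone) : IsAffineHom (Δ.coxChart R σ) := by
  refine isAffineHom_of_forall_exists_isAffineOpen _ fun y => ?_
  obtain ⟨τ, x, rfl⟩ := Δ.coxChart_jointly_surjective R y
  refine ⟨(Δ.coxChart R τ).opensRange, ⟨x, rfl⟩, isAffineOpen_opensRange _, ?_⟩
  rw [coxChart_preimage_opensRange]
  exact isAffineOpen_opensRange _

/-- The quasicoherent ideal on `Y_σ(R)` associated with an ideal of `S_(σ)`. -/
noncomputable def chartIdeal {σ : Δ.Cone} (K : Ideal (Δ.degZero R σ)) :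
    (Spec (CommRingCat.of (Δ.degZero R σ))).IdealSheafData :=
  Scheme.IdealSheafData.ofIdealTop
    (K.map (Scheme.ΓSpecIso (CommRingCat.of (Δ.degZero R σ))).inv.hom)

theorem chartIdeal_bijective (σ : Δ.Cone) :
    Function.Bijective (Δ.chartIdeal R : Ideal (Δ.degZero R σ) → _) :=
  Scheme.IdealSheafData.equivOfIsAffine.symm.bijective.comp
    (Scheme.ΓSpecIso (CommRingCat.of
      (Δ.degZero R σ))).symm.commRingCatIsoToRingEquiv.idealComapOrderIso.symm.bijective

theorem chartIdeal_comap {τ σ : Δ.Cone} (h : τ ≤ σ) (K : Ideal (Δ.degZero R σ)) :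
    (Δ.chartIdeal R K).comap (Δ.coxFaceMap R h) = Δ.chartIdeal R (K.map (Δ.degZeroMap R h)) := by
  rw [chartIdeal, ofIdealTop_comap, chartIdeal, Ideal.map_map, Ideal.map_map]
  congr 2
  rw [← CommRingCat.hom_comp]
  exact congrArg CommRingCat.Hom.hom
    (Scheme.ΓSpecIso_inv_naturality (CommRingCat.ofHom (Δ.degZeroMap R h))).symm

/-- A family of ideals `K_σ` of the rings `S_(σ)` is compatible if `K_τ` is the extension of
`K_σ` for every face `τ` of `σ`. -/
def IsCompatible (K : ∀ σ : Δ.Cone, Ideal (Δ.degZero R σ)) : Prop :=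
  ∀ ⦃τ σ : Δ.Cone⦄ (h : τ ≤ σ), K τ = (K σ).map (Δ.degZeroMap R h)

variable {R}

/-- Glueing of quasicoherent ideals: a compatible family of ideals comes from the infimum of the
direct images of its members. -/
theorem IsCompatible.comap_iInf_map {K : ∀ σ : Δ.Cone, Ideal (Δ.degZero R σ)}
    (hK : Δ.IsCompatible R K) (τ : Δ.Cone) :
    (⨅ σ, (Δ.chartIdeal R (K σ)).map (Δ.coxChart R σ)).comap (Δ.coxChart R τ) =
      Δ.chartIdeal R (K τ) := by
  apply le_antisymm
  · rw [← Scheme.IdealSheafData.le_map_iff_comap_le]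
    exact iInf_le _ τ
  · have key : ∀ σ, Δ.chartIdeal R (K τ) ≤
        ((Δ.chartIdeal R (K σ)).map (Δ.coxChart R σ)).comap (Δ.coxChart R τ) := by
      intro σ
      rw [comap_map_of_isPullback (Δ.isPullback_coxChart R σ τ),
        Scheme.IdealSheafData.le_map_iff_comap_le, chartIdeal_comap, chartIdeal_comap,
        ← hK, ← hK]
    intro U
    rw [Scheme.IdealSheafData.ideal_comap_of_isOpenImmersion,
      Scheme.IdealSheafData.ideal_iInf, iInf_apply, Ideal.comap_iInf]
    refine le_iInf fun σ => ?_
    have := key σ U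
    rwa [Scheme.IdealSheafData.ideal_comap_of_isOpenImmersion] at this

theorem IsCompatible.eq_iInf_map_iff {K : ∀ σ : Δ.Cone, Ideal (Δ.degZero R σ)}
    (hK : Δ.IsCompatible R K) (J : (Δ.coxScheme R).IdealSheafData) :
    J = ⨅ σ, (Δ.chartIdeal R (K σ)).map (Δ.coxChart R σ) ↔
      ∀ σ, J.comap (Δ.coxChart R σ) = Δ.chartIdeal R (K σ) := by
  constructor
  · rintro rfl σ
    exact hK.comap_iInf_map Δ σ
  · intro h
    exact ext_of_comap_eq (Δ.coxChart R) (Δ.coxChart_jointly_surjective R)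
      fun σ => (h σ).trans (hK.comap_iInf_map Δ σ).symm

theorem exists_isCompatible (J : (Δ.coxScheme R).IdealSheafData) :
    ∃ K : ∀ σ : Δ.Cone, Ideal (Δ.degZero R σ), Δ.IsCompatible R K ∧
      ∀ σ, J.comap (Δ.coxChart R σ) = Δ.chartIdeal R (K σ) := by
  choose K hK using fun σ => (Δ.chartIdeal_bijective R σ).2 (J.comap (Δ.coxChart R σ))
  refine ⟨K, fun τ σ h => (Δ.chartIdeal_bijective R τ).1 ?_, fun σ => (hK σ).symm⟩
  rw [hK, ← chartIdeal_comap, hK, ← Scheme.IdealSheafData.comap_comp, coxFaceMap_chart]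

end Glue

/-! ### The rings `S_(σ)` inside the ring of Laurent polynomials -/

section LaurentRing

variable {V : Type v} [AddCommGroup V] [Module ℝ V] [FiniteDimensional ℝ V] {N : AddSubgroup V}
  [IsZStructure N] (Δ : Fan N) (R : Type u) [CommRing R]

/-- The ring of Laurent polynomials in the variables `Z_ρ`. -/
abbrev Laurent : Type (max u v) := AddMonoidAlgebra R (Δ.Ray → ℤ)

/-- The Laurent monomial with exponent `s`. -/
noncomputable def laurentMonomial (s : Δ.Ray → ℤ) : Δ.Laurent R := AddMonoidAlgebra.single s 1

theorem laurentMonomial_add (s t : Δ.Ray → ℤ) :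
    Δ.laurentMonomial R (s + t) = Δ.laurentMonomial R s * Δ.laurentMonomial R t := by
  simp [laurentMonomial, AddMonoidAlgebra.single_mul_single]

theorem laurentMonomial_zero : Δ.laurentMonomial R 0 = 1 := rfl

theorem laurentMonomial_nsmul (k : ℕ) (s : Δ.Ray → ℤ) :
    Δ.laurentMonomial R (k • s) = Δ.laurentMonomial R s ^ k := by
  induction k with
  | zero => simp [laurentMonomial_zero]
  | succ k ih => rw [succ_nsmul, laurentMonomial_add, ih, pow_succ]

theorem isUnit_laurentMonomial (s : Δ.Ray → ℤ) : IsUnit (Δ.laurentMonomial R s) :=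
  IsUnit.of_mul_eq_one (Δ.laurentMonomial R (-s)) <| by
    rw [← laurentMonomial_add, add_neg_cancel, laurentMonomial_zero]

/-- The inclusion of the exponents of monomials into the exponents of Laurent monomials. -/
def expHom : (Δ.Ray →₀ ℕ) →+ (Δ.Ray → ℤ) where
  toFun e := fun ρ => (e ρ : ℤ)
  map_zero' := by funext ρ; simp
  map_add' e e' := by funext ρ; simp

theorem expHom_apply (e : Δ.Ray →₀ ℕ) (ρ : Δ.Ray) : Δ.expHom e ρ = e ρ := rfl

theorem expHom_injective : Function.Injective Δ.expHom := fun e e' h => by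
  ext ρ
  have := congrFun h ρ
  rw [expHom_apply, expHom_apply] at this
  exact_mod_cast this

theorem exists_expHom_eq {s : Δ.Ray → ℤ} (hs : 0 ≤ s) : ∃ e, Δ.expHom e = s :=
  ⟨Finsupp.equivFunOnFinite.symm fun ρ => (s ρ).toNat, by
    funext ρ
    rw [expHom_apply, Finsupp.equivFunOnFinite_symm_apply_apply, Int.toNat_of_nonneg (hs ρ)]⟩

/-- The inclusion of the Cox ring into the ring of Laurent polynomials. -/
noncomputable def toLaurent : Δ.Cox R →+* Δ.Laurent R :=
  AddMonoidAlgebra.mapDomainRingHom R Δ.expHom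

theorem toLaurent_injective : Function.Injective (Δ.toLaurent R) :=
  AddMonoidAlgebra.mapDomain_injective Δ.expHom_injective

theorem toLaurent_monomial (e : Δ.Ray →₀ ℕ) :
    Δ.toLaurent R (MvPolynomial.monomial e 1) = Δ.laurentMonomial R (Δ.expHom e) :=
  AddMonoidAlgebra.mapDomain_single

theorem weight_eq (e : Δ.Ray →₀ ℕ) :
    Finsupp.weight Δ.rayClass e = Δ.toA (Δ.expHom e) := Δ.weight_rayClass e

theorem monomial_mem_coxGrading {e : Δ.Ray →₀ ℕ} {α : Δ.A} (h : Δ.toA (Δ.expHom e) = α) (c : R) :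
    MvPolynomial.monomial e c ∈ Δ.coxGrading R α :=
  MvPolynomial.isWeightedHomogeneous_monomial _ _ _ ((Δ.weight_eq e).trans h)

/-- The exponent of `Ẑ_σ`: the indicator function of the rays that do not belong to `σ`. -/
noncomputable def offRays (σ : Δ.Cone) : Δ.Ray → ℤ :=
  open Classical in fun ρ => if Δ.IsRayOf ρ σ then 0 else 1

variable {Δ} in
theorem offRays_of_isRayOf {σ : Δ.Cone} {ρ : Δ.Ray} (h : Δ.IsRayOf ρ σ) : Δ.offRays σ ρ = 0 :=
  if_pos h

variable {Δ} in
theorem offRays_of_not_isRayOf {σ : Δ.Cone} {ρ : Δ.Ray} (h : ¬ Δ.IsRayOf ρ σ) :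
    Δ.offRays σ ρ = 1 :=
  if_neg h

theorem toA_offRays (σ : Δ.Cone) : Δ.toA (Δ.offRays σ) = Δ.hatDeg σ := rfl

theorem exists_hatZ_eq_monomial (σ : Δ.Cone) :
    ∃ e, Δ.expHom e = Δ.offRays σ ∧ Δ.hatZ R σ = MvPolynomial.monomial e 1 := by
  classical
  refine ⟨∑ ρ with ¬ Δ.IsRayOf ρ σ, Finsupp.single ρ 1, ?_, by rw [hatZ, prod_X_eq]⟩
  funext ρ
  rw [expHom_apply, sum_single_apply, offRays]
  simp

theorem toLaurent_hatZ (σ : Δ.Cone) :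
    Δ.toLaurent R (Δ.hatZ R σ) = Δ.laurentMonomial R (Δ.offRays σ) := by
  obtain ⟨e, he, h⟩ := Δ.exists_hatZ_eq_monomial R σ
  rw [h, toLaurent_monomial, he]

/-- The inclusion of `S_(σ)` into the ring of Laurent polynomials. -/
noncomputable def chartToLaurent (σ : Δ.Cone) : Δ.degZero R σ →+* Δ.Laurent R :=
  (Localization.awayLift (Δ.toLaurent R) (Δ.hatZ R σ)
    (by rw [toLaurent_hatZ]; exact Δ.isUnit_laurentMonomial R _)).comp
    (algebraMap (Δ.degZero R σ) (Localization.Away (Δ.hatZ R σ)))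

theorem chartToLaurent_mk (σ : Δ.Cone) (k : ℕ) (f : Δ.Cox R)
    (hf : f ∈ Δ.coxGrading R (k • Δ.hatDeg σ)) :
    Δ.chartToLaurent R σ
        (HomogeneousLocalization.Away.mk (Δ.coxGrading R) (Δ.hatZ_mem R σ) k f hf) =
      Δ.toLaurent R f * Δ.laurentMonomial R (-(k • Δ.offRays σ)) := by
  rw [chartToLaurent, RingHom.comp_apply, HomogeneousLocalization.algebraMap_apply,
    HomogeneousLocalization.Away.val_mk, ← smul_neg, laurentMonomial_nsmul]
  refine Localization.awayLift_mk _ _ _ _ (?_ : _ * Δ.laurentMonomial R (-Δ.offRays σ) = 1) _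
  rw [toLaurent_hatZ, ← laurentMonomial_add, add_neg_cancel, laurentMonomial_zero]

theorem chartToLaurent_injective (σ : Δ.Cone) : Function.Injective (Δ.chartToLaurent R σ) := by
  rw [injective_iff_map_eq_zero]
  intro x hx
  obtain ⟨k, f, hf, rfl⟩ := HomogeneousLocalization.Away.mk_surjective _ (Δ.hatZ_mem R σ) x
  rw [chartToLaurent_mk, (Δ.isUnit_laurentMonomial R _).mul_left_eq_zero] at hx
  have : f = 0 := Δ.toLaurent_injective R (hx.trans (map_zero _).symm)
  subst this
  apply HomogeneousLocalization.val_injective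
  simp [HomogeneousLocalization.Away.val_mk, Localization.mk_zero]

theorem chartToLaurent_degZeroMap {τ σ : Δ.Cone} (h : τ ≤ σ) (x : Δ.degZero R σ) :
    Δ.chartToLaurent R τ (Δ.degZeroMap R h x) = Δ.chartToLaurent R σ x := by
  obtain ⟨k, f, hf, rfl⟩ := HomogeneousLocalization.Away.mk_surjective _ (Δ.hatZ_mem R σ) x
  have hrel : Δ.laurentMonomial R (Δ.offRays τ) =
      Δ.laurentMonomial R (Δ.offRays σ) * Δ.toLaurent R (Δ.relZ R τ σ) := by
    rw [← toLaurent_hatZ, ← toLaurent_hatZ, ← map_mul, ← Δ.hatZ_eq_mul_relZ R h]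
  have hmem : f * Δ.relZ R τ σ ^ k ∈ Δ.coxGrading R (k • Δ.hatDeg τ) := by
    have hdeg : Δ.hatDeg τ = Δ.hatDeg σ + Δ.relDeg τ σ := by
      rw [hatDeg, hatDeg, relDeg, ← map_add]
      congr 1
      funext ρ
      have h1 : Δ.IsRayOf ρ τ → Δ.IsRayOf ρ σ := fun h' => le_trans h' h
      by_cases h2 : Δ.IsRayOf ρ τ <;> by_cases h3 : Δ.IsRayOf ρ σ <;> simp_all
    rw [hdeg, nsmul_add]
    exact SetLike.mul_mem_graded hf (SetLike.pow_mem_graded k (Δ.relZ_mem R τ σ))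
  have : Δ.degZeroMap R h
      (HomogeneousLocalization.Away.mk (Δ.coxGrading R) (Δ.hatZ_mem R σ) k f hf) =
      HomogeneousLocalization.Away.mk (Δ.coxGrading R) (Δ.hatZ_mem R τ) k _ hmem := by
    rw [degZeroMap, HomogeneousLocalization.awayMap_mk]
    apply HomogeneousLocalization.val_injective
    simp only [HomogeneousLocalization.Away.val_mk]
  rw [this, chartToLaurent_mk, chartToLaurent_mk]
  rw [← (Δ.isUnit_laurentMonomial R (k • Δ.offRays τ)).mul_left_inj, mul_assoc,
    ← laurentMonomial_add, neg_add_cancel, laurentMonomial_zero, mul_one,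
    laurentMonomial_nsmul, hrel, mul_pow, ← laurentMonomial_nsmul, map_mul, map_pow]
  rw [mul_assoc, ← mul_assoc (Δ.laurentMonomial R _), ← laurentMonomial_add, neg_add_cancel,
    laurentMonomial_zero, one_mul]

theorem exists_le_nsmul_offRays (σ : Δ.Cone) {s : Δ.Ray → ℤ}
    (hs : ∀ ρ, Δ.IsRayOf ρ σ → 0 ≤ s ρ) : ∃ K : ℕ, ∀ k, K ≤ k → 0 ≤ s + k • Δ.offRays σ := by
  refine ⟨∑ ρ, (s ρ).natAbs, fun k hk ρ => ?_⟩
  have h1 := Finset.single_le_sum (f := fun ρ => (s ρ).natAbs) (fun _ _ => Nat.zero_le _)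
    (Finset.mem_univ ρ)
  rw [Pi.zero_apply, Pi.add_apply, Pi.smul_apply]
  by_cases h : Δ.IsRayOf ρ σ
  · rw [offRays_of_isRayOf h]
    simpa using hs ρ h
  · rw [offRays_of_not_isRayOf h]
    simp only [nsmul_eq_mul, mul_one]
    lia

/-- The image of `S_(σ)` in the ring of Laurent polynomials contains the elements of degree zero
all of whose exponents are nonnegative on the rays of `σ`. -/
theorem exists_chartToLaurent_eq (σ : Δ.Cone) {α : Δ.A} {f : Δ.Cox R}
    (hf : f ∈ Δ.coxGrading R α) {s : Δ.Ray → ℤ} (hsα : Δ.toA s = -α)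
    (hs : ∀ ρ, Δ.IsRayOf ρ σ → 0 ≤ s ρ) :
    ∃ x, Δ.chartToLaurent R σ x = Δ.toLaurent R f * Δ.laurentMonomial R s := by
  obtain ⟨k, hk⟩ := Δ.exists_le_nsmul_offRays σ hs
  obtain ⟨e, he⟩ := Δ.exists_expHom_eq (hk k le_rfl)
  have hmem : f * MvPolynomial.monomial e 1 ∈ Δ.coxGrading R (k • Δ.hatDeg σ) := by
    have h1 := SetLike.mul_mem_graded hf (Δ.monomial_mem_coxGrading R (e := e) rfl 1)
    rwa [he, map_add, hsα, map_nsmul, toA_offRays, add_neg_cancel_left] at h1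
  refine ⟨HomogeneousLocalization.Away.mk (Δ.coxGrading R) (Δ.hatZ_mem R σ) k _ hmem, ?_⟩
  rw [chartToLaurent_mk, map_mul, toLaurent_monomial, he, mul_assoc, ← laurentMonomial_add,
    add_neg_cancel_right]

theorem exists_chartToLaurent_eq_laurentMonomial (σ : Δ.Cone) {s : Δ.Ray → ℤ}
    (hs0 : Δ.toA s = 0) (hs : ∀ ρ, Δ.IsRayOf ρ σ → 0 ≤ s ρ) :
    ∃ x, Δ.chartToLaurent R σ x = Δ.laurentMonomial R s := by
  obtain ⟨x, hx⟩ := Δ.exists_chartToLaurent_eq R σ (SetLike.one_mem_graded (Δ.coxGrading R))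
    (hs0.trans neg_zero.symm) hs
  exact ⟨x, by rw [hx, map_one, one_mul]⟩

theorem toA_charMap (u : dualLattice N) : Δ.toA (Δ.charMap u) = 0 :=
  (QuotientAddGroup.eq_zero_iff _).2 ⟨u, rfl⟩

/-- An ideal of `S_(σ)` extended to `S_(τ)`, for the face `τ` of `σ` cut out by `u`: its elements
are those that are multiplied into the ideal by a power of the monomial with exponent `c(u)`. -/
theorem mem_map_degZeroMap_iff {τ σ : Δ.Cone} (h : τ ≤ σ) {u : dualLattice N}
    (hu : CutsOut u.1 τ.1 σ.1) (K : Ideal (Δ.degZero R σ)) (y : Δ.degZero R τ) :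
    y ∈ K.map (Δ.degZeroMap R h) ↔ ∃ j : ℕ, ∃ x ∈ K,
      Δ.chartToLaurent R σ x =
        Δ.chartToLaurent R τ y * Δ.laurentMonomial R (j • Δ.charMap u) := by
  obtain ⟨k, hk⟩ := Δ.exists_bound u
  let _ := (Δ.degZeroMap R h).toAlgebra
  have := Δ.faceElt_isLocalization R h hu hk
  have ht : Δ.chartToLaurent R σ (Δ.faceElt R hu.1 hk) = Δ.laurentMonomial R (Δ.charMap u) := by
    have he : Δ.expHom (Δ.faceExp σ u k) = Δ.charMap u + k • Δ.offRays σ := by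
      funext ρ
      rw [expHom_apply, Δ.faceExp_apply hu.1 hk, Pi.add_apply, Pi.smul_apply, offRays]
      simp
    rw [faceElt, chartToLaurent_mk, toLaurent_monomial, he, ← laurentMonomial_add,
      add_neg_cancel_right]
  have hmap : K.map (Δ.degZeroMap R h) = K.map (algebraMap (Δ.degZero R σ) (Δ.degZero R τ)) := rfl
  rw [hmap, IsLocalization.mem_map_algebraMap_iff (Submonoid.powers (Δ.faceElt R hu.1 hk))]
  have key : ∀ (j : ℕ) (x : Δ.degZero R σ),
      y * Δ.degZeroMap R h (Δ.faceElt R hu.1 hk ^ j) = Δ.degZeroMap R h x ↔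
      Δ.chartToLaurent R σ x =
        Δ.chartToLaurent R τ y * Δ.laurentMonomial R (j • Δ.charMap u) := by
    intro j x
    rw [← (Δ.chartToLaurent_injective R τ).eq_iff, map_mul, chartToLaurent_degZeroMap,
      chartToLaurent_degZeroMap, map_pow, ht, laurentMonomial_nsmul, eq_comm]
  constructor
  · rintro ⟨⟨⟨x, hx⟩, ⟨_, j, rfl⟩⟩, hxy⟩
    exact ⟨j, x, hx, (key j x).1 hxy⟩
  · rintro ⟨j, x, hx, hxy⟩
    exact ⟨⟨⟨x, hx⟩, ⟨_, j, rfl⟩⟩, (key j x).2 hxy⟩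

end LaurentRing

/-! ### Localization and saturation of ideals of the restricted Cox ring -/

section SaturatedIdeals

variable {V : Type v} [AddCommGroup V] [Module ℝ V] [FiniteDimensional ℝ V] {N : AddSubgroup V}
  [IsZStructure N] (Δ : Fan N) (R : Type u) [CommRing R] (B : AddSubgroup Δ.A)

theorem coe_decompose_cox (f : Δ.Cox R) (α : Δ.A) :
    (DirectSum.decompose (Δ.coxGrading R) f α : Δ.Cox R) =
      MvPolynomial.weightedHomogeneousComponent Δ.rayClass α f :=
  MvPolynomial.weightedDecomposition.decompose'_apply R Δ.rayClass f α

theorem coe_decompose_restrict (f : Δ.coxRestrict R B) (β : B) :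
    (DirectSum.decompose (Δ.restrictGrading R B) f β : Δ.coxRestrict R B).1 =
      DirectSum.decompose (Δ.coxGrading R) f.1 β.1 := by
  rw [coe_decompose_cox]
  exact Δ.restrictDecompose_apply R B f β

variable {B}

/-- There are arbitrarily high powers of `Ẑ_σ` of degree in a subgroup `B` of finite index. -/
theorem exists_hatZ_pow_mem [B.FiniteIndex] (σ : Δ.Cone) (K : ℕ) :
    ∃ k, K ≤ k ∧ k • Δ.hatDeg σ ∈ B := by
  refine ⟨K * B.index, Nat.le_mul_of_pos_right _
    (Nat.pos_of_ne_zero AddSubgroup.FiniteIndex.index_ne_zero), ?_⟩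
  rw [mul_nsmul']
  exact nsmul_mem (B.nsmul_index_mem _) K

/-- A power of `Ẑ_σ` of degree in `B`, as an element of `S_B`. -/
noncomputable def hatPow (σ : Δ.Cone) {k : ℕ} (hk : k • Δ.hatDeg σ ∈ B) : Δ.coxRestrict R B :=
  ⟨Δ.hatZ R σ ^ k,
    Δ.mem_coxRestrict_of_mem R B hk (SetLike.pow_mem_graded k (Δ.hatZ_mem R σ))⟩

theorem toLaurent_hatPow (σ : Δ.Cone) {k : ℕ} (hk : k • Δ.hatDeg σ ∈ B) :
    Δ.toLaurent R (Δ.hatPow R σ hk).1 = Δ.laurentMonomial R (k • Δ.offRays σ) := by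
  rw [hatPow, map_pow, toLaurent_hatZ, laurentMonomial_nsmul]

/-- A monomial of degree in `B`, as an element of `S_B`. -/
noncomputable def restrictMonomial {e : Δ.Ray →₀ ℕ} (he : Δ.toA (Δ.expHom e) ∈ B) (c : R) :
    Δ.coxRestrict R B :=
  ⟨MvPolynomial.monomial e c,
    Δ.mem_coxRestrict_of_mem R B he (Δ.monomial_mem_coxGrading R rfl c)⟩

theorem coe_restrictMonomial {e : Δ.Ray →₀ ℕ} (he : Δ.toA (Δ.expHom e) ∈ B) (c : R) :
    (Δ.restrictMonomial R he c).1 = MvPolynomial.monomial e c := rfl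

theorem exists_of_mem_locIdeal [B.FiniteIndex] {𝔞 : Ideal (Δ.coxRestrict R B)} {σ : Δ.Cone}
    {x : Δ.degZero R σ} (hx : x ∈ Δ.locIdeal R B 𝔞 σ) :
    ∃ k : ℕ, k • Δ.hatDeg σ ∈ B ∧ ∃ f ∈ 𝔞, f.1 ∈ Δ.coxGrading R (k • Δ.hatDeg σ) ∧
      Δ.chartToLaurent R σ x =
        Δ.toLaurent R f.1 * Δ.laurentMonomial R (-(k • Δ.offRays σ)) := by
  obtain ⟨k, hk, f, hf𝔞, hf, rfl⟩ := hx
  -- Over the zero ring, `Ẑ_σ ^ k ∈ S_B` carries no information on the degree of `Ẑ_σ ^ k`.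
  rcases subsingleton_or_nontrivial R with hR | hR
  · refine ⟨0, by rw [zero_nsmul]; exact zero_mem _, 0, zero_mem _, zero_mem _, ?_⟩
    have : Subsingleton (Δ.Laurent R) := inferInstance
    exact Subsingleton.elim _ _
  · refine ⟨k, ?_, f, hf𝔞, hf, Δ.chartToLaurent_mk R σ k f.1 hf⟩
    obtain ⟨e, he, h⟩ := Δ.exists_hatZ_eq_monomial R σ
    have h1 := hk (k • e) (by
      rw [h, MvPolynomial.monomial_pow, one_pow, MvPolynomial.coeff_monomial, if_pos rfl]
      exact one_ne_zero)
    rwa [weight_eq, map_nsmul, he, map_nsmul, toA_offRays] at h1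

/-- Elements of `𝔞_(σ)` may be written with any Laurent monomial without poles along the rays of `σ`
in place of a power of `Ẑ_σ` in the denominator. -/
theorem mem_locIdeal_of_eq [B.FiniteIndex] {𝔞 : Ideal (Δ.coxRestrict R B)} {σ : Δ.Cone}
    {α : Δ.A} (hα : α ∈ B) {f : Δ.coxRestrict R B} (hf𝔞 : f ∈ 𝔞)
    (hf : f.1 ∈ Δ.coxGrading R α) {s : Δ.Ray → ℤ} (hsα : Δ.toA s = -α)
    (hs : ∀ ρ, Δ.IsRayOf ρ σ → 0 ≤ s ρ) {x : Δ.degZero R σ}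
    (hx : Δ.chartToLaurent R σ x = Δ.toLaurent R f.1 * Δ.laurentMonomial R s) :
    x ∈ Δ.locIdeal R B 𝔞 σ := by
  obtain ⟨K, hK⟩ := Δ.exists_le_nsmul_offRays σ hs
  obtain ⟨k, hKk, hk⟩ := Δ.exists_hatZ_pow_mem (B := B) σ K
  obtain ⟨e, he⟩ := Δ.exists_expHom_eq (hK k hKk)
  have hdeg : Δ.toA (Δ.expHom e) = -α + k • Δ.hatDeg σ := by
    rw [he, map_add, hsα, map_nsmul, toA_offRays]
  have heB : Δ.toA (Δ.expHom e) ∈ B := hdeg ▸ add_mem (neg_mem hα) hk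
  have hmem : (f * Δ.restrictMonomial R heB 1).1 ∈ Δ.coxGrading R (k • Δ.hatDeg σ) := by
    have h1 := SetLike.mul_mem_graded hf (Δ.monomial_mem_coxGrading R hdeg 1)
    rwa [add_neg_cancel_left] at h1
  refine ⟨k, (Δ.hatPow R σ hk).2, f * Δ.restrictMonomial R heB 1,
    𝔞.mul_mem_right _ hf𝔞, hmem, Δ.chartToLaurent_injective R σ ?_⟩
  rw [chartToLaurent_mk, hx, Subalgebra.coe_mul, map_mul, coe_restrictMonomial,
    toLaurent_monomial, he, mul_assoc, ← laurentMonomial_add, add_neg_cancel_right]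

theorem charMap_pos {τ σ : Δ.Cone} {u : dualLattice N} (hu : CutsOut u.1 τ.1 σ.1) {ρ : Δ.Ray}
    (hσ : Δ.IsRayOf ρ σ) (hτ : ¬ Δ.IsRayOf ρ τ) : 1 ≤ Δ.charMap u ρ :=
  (Δ.charMap_nonneg hu.1 hσ).lt_of_ne fun h => hτ ((Δ.charMap_eq_zero_iff hu hσ).1 h.symm)

/-- The ideals `𝔞_(σ)` are compatible with the glueing of the schemes `Y_σ`. -/
theorem isCompatible_locIdeal [B.FiniteIndex] (𝔞 : Ideal (Δ.coxRestrict R B)) :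
    Δ.IsCompatible R (Δ.locIdeal R B 𝔞) := by
  intro τ σ h
  apply le_antisymm
  · intro y hy
    obtain ⟨k, hk, f, hf𝔞, hf, hyf⟩ := Δ.exists_of_mem_locIdeal R hy
    obtain ⟨u, huM, hu⟩ := (Δ.le_iff_isFace τ σ).1 h
    have hu' : CutsOut (⟨u, huM⟩ : dualLattice N).1 τ.1 σ.1 := hu
    rw [Δ.mem_map_degZeroMap_iff R h hu']
    -- The `k`-th power of the monomial cancels the poles of order `k` along the rays of `σ`
    -- outside `τ`.
    have hs : ∀ ρ, Δ.IsRayOf ρ σ →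
        0 ≤ (-(k • Δ.offRays τ) + k • Δ.charMap ⟨u, huM⟩ : Δ.Ray → ℤ) ρ := by
      intro ρ hρ
      simp only [Pi.add_apply, Pi.neg_apply, Pi.smul_apply]
      by_cases hρτ : Δ.IsRayOf ρ τ
      · rw [offRays_of_isRayOf hρτ, (Δ.charMap_eq_zero_iff hu' hρ).2 hρτ]
        simp
      · rw [offRays_of_not_isRayOf hρτ]
        have := nsmul_le_nsmul_right (Δ.charMap_pos hu' hρ hρτ) k
        linarith
    have hsα : Δ.toA (-(k • Δ.offRays τ) + k • Δ.charMap ⟨u, huM⟩) = -(k • Δ.hatDeg τ) := by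
      rw [map_add, map_neg, map_nsmul, map_nsmul, toA_charMap, toA_offRays, nsmul_zero, add_zero]
    obtain ⟨x, hx⟩ := Δ.exists_chartToLaurent_eq R σ hf hsα hs
    refine ⟨k, x, Δ.mem_locIdeal_of_eq R hk hf𝔞 hf hsα hs hx, ?_⟩
    rw [hx, hyf, mul_assoc, ← laurentMonomial_add]
  · rw [Ideal.map_le_iff_le_comap]
    intro x hx
    obtain ⟨k, hk, f, hf𝔞, hf, hxf⟩ := Δ.exists_of_mem_locIdeal R hx
    refine Δ.mem_locIdeal_of_eq R hk hf𝔞 hf (s := -(k • Δ.offRays σ)) ?_ ?_ ?_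
    · rw [map_neg, map_nsmul, toA_offRays]
    · intro ρ hρ
      have : Δ.IsRayOf ρ σ := le_trans hρ h
      simp [offRays_of_isRayOf this]
    · rw [chartToLaurent_degZeroMap, hxf]

theorem isSaturated_of_forall [B.FiniteIndex] {𝔞 : Ideal (Δ.coxRestrict R B)}
    (h : ∀ f, (∀ σ : Δ.Cone, ∃ (k : ℕ) (hk : k • Δ.hatDeg σ ∈ B), f * Δ.hatPow R σ hk ∈ 𝔞) →
      f ∈ 𝔞) : Δ.IsSaturated R B 𝔞 := by
  apply subset_antisymm
  · intro f hf
    exact Set.mem_iUnion.2 ⟨0, Submodule.mem_colon.2 fun y _ => 𝔞.mul_mem_right y hf⟩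
  · intro f hf
    obtain ⟨K, hK⟩ := Set.mem_iUnion.1 hf
    refine h f fun σ => ?_
    obtain ⟨k, hk1, hk⟩ := Δ.exists_hatZ_pow_mem (B := B) σ 1
    have hkK : (k * K) • Δ.hatDeg σ ∈ B := by
      rw [mul_nsmul]
      exact nsmul_mem hk K
    refine ⟨k * K, hkK, Submodule.mem_colon.1 hK _ ?_⟩
    have : Δ.hatPow R σ hkK = Δ.hatPow R σ hk ^ K := Subtype.ext (pow_mul _ _ _)
    rw [this]
    refine Ideal.pow_mem_pow ?_ K
    change Δ.hatZ R σ ^ k ∈ Δ.irrelevantIdeal R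
    exact Ideal.pow_mem_of_mem _ (Ideal.subset_span (Set.mem_range_self σ)) k hk1

/-- An element of a saturated ideal can be detected up to powers of the monomials `Ẑ_σ`: some
power of the ideal `I` is contained in the ideal generated by given powers of the `Ẑ_σ`. -/
theorem IsSaturated.mem_of_forall {𝔞 : Ideal (Δ.coxRestrict R B)} (h𝔞 : Δ.IsSaturated R B 𝔞)
    {f : Δ.coxRestrict R B}
    (hf : ∀ σ : Δ.Cone, ∃ (k : ℕ) (hk : k • Δ.hatDeg σ ∈ B), f * Δ.hatPow R σ hk ∈ 𝔞) :
    f ∈ 𝔞 := by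
  choose k hk hfk using hf
  choose e he hZ using Δ.exists_hatZ_eq_monomial R
  have hpow : ∀ σ, Δ.hatZ R σ ^ k σ = MvPolynomial.monomial (k σ • e σ) 1 := fun σ => by
    rw [hZ, MvPolynomial.monomial_pow, one_pow]
  let P : Ideal (Δ.Cox R) :=
    Ideal.span ((fun s => MvPolynomial.monomial s (1 : R)) '' Set.range fun σ => k σ • e σ)
  have hrad : Δ.irrelevantIdeal R ≤ P.radical := by
    refine Ideal.span_le.2 ?_
    rintro _ ⟨σ, rfl⟩
    exact Ideal.mem_radical_iff.2 ⟨k σ, hpow σ ▸ Ideal.subset_span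
      (Set.mem_image_of_mem _ (Set.mem_range_self σ))⟩
  obtain ⟨K, hK⟩ := Ideal.exists_pow_le_of_le_radical_of_fg hrad
    (Submodule.fg_span (Set.finite_range _))
  rw [← SetLike.mem_coe, h𝔞]
  refine Set.mem_iUnion.2 ⟨K, Submodule.mem_colon.2 fun y hy => ?_⟩
  have hyP : y.1 ∈ P := hK (Ideal.le_comap_pow (Δ.coxRestrict R B).val.toRingHom K hy)
  rw [MvPolynomial.mem_ideal_span_monomial_image] at hyP
  -- Membership in `𝔞` is checked in `S`, where `y` is the sum of its monomials.
  let T : AddSubgroup (Δ.Cox R) :=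
    𝔞.toAddSubgroup.map (Δ.coxRestrict R B).val.toRingHom.toAddMonoidHom
  have hT : ∀ g : Δ.coxRestrict R B, g.1 ∈ T ↔ g ∈ 𝔞 := fun g =>
    ⟨fun ⟨g', hg', hgg'⟩ => Subtype.ext (show g'.1 = g.1 from hgg') ▸ hg', fun hg => ⟨g, hg, rfl⟩⟩
  rw [← hT, smul_eq_mul, Subalgebra.coe_mul, MvPolynomial.as_sum y.1, Finset.mul_sum]
  refine sum_mem fun s hs => ?_
  obtain ⟨_, ⟨σ, rfl⟩, hle⟩ := hyP s hs
  have hsB : Δ.toA (Δ.expHom s) ∈ B := by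
    rw [← weight_eq]
    exact y.2 s (MvPolynomial.mem_support_iff.1 hs)
  have hquot : Δ.toA (Δ.expHom (s - k σ • e σ)) ∈ B := by
    have h1 : Δ.toA (Δ.expHom (s - k σ • e σ)) + k σ • Δ.hatDeg σ = Δ.toA (Δ.expHom s) := by
      rw [← toA_offRays, ← he, ← map_nsmul, ← map_nsmul, ← map_add, ← map_add,
        tsub_add_cancel_of_le hle]
    rw [← h1] at hsB
    exact (add_mem_cancel_right (hk σ)).1 hsB
  have hmon : MvPolynomial.monomial s (y.1.coeff s) =
      Δ.hatZ R σ ^ k σ * MvPolynomial.monomial (s - k σ • e σ) (y.1.coeff s) := by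
    rw [hpow, MvPolynomial.monomial_mul, one_mul, add_tsub_cancel_of_le hle]
  rw [hmon, ← mul_assoc]
  exact (hT (f * Δ.hatPow R σ (hk σ) * Δ.restrictMonomial R hquot _)).2
    (𝔞.mul_mem_right _ (hfk σ))

/-! ### Small groups of degrees -/

theorem mem_closure_rayClass_iff (σ : Δ.Cone) (α : Δ.A) :
    α ∈ AddSubgroup.closure {α | ∃ ρ, ¬ Δ.IsRayOf ρ σ ∧ α = Δ.rayClass ρ} ↔
      ∃ s : Δ.Ray → ℤ, (∀ ρ, Δ.IsRayOf ρ σ → s ρ = 0) ∧ Δ.toA s = α := by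
  classical
  constructor
  · intro h
    induction h using AddSubgroup.closure_induction with
    | mem x hx =>
      obtain ⟨ρ, hρ, rfl⟩ := hx
      refine ⟨Pi.single ρ 1, fun ρ' hρ' => ?_, ?_⟩
      · rw [Pi.single_eq_of_ne]
        rintro rfl
        exact hρ hρ'
      · rw [rayClass]
    | zero => exact ⟨0, fun _ _ => rfl, map_zero _⟩
    | add x y _ _ hx hy =>
      obtain ⟨s, hs, rfl⟩ := hx
      obtain ⟨t, ht, rfl⟩ := hy
      exact ⟨s + t, fun ρ hρ => by rw [Pi.add_apply, hs ρ hρ, ht ρ hρ, add_zero], map_add _ _ _⟩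
    | neg x _ hx =>
      obtain ⟨s, hs, rfl⟩ := hx
      exact ⟨-s, fun ρ hρ => by rw [Pi.neg_apply, hs ρ hρ, neg_zero], map_neg _ _⟩
  · rintro ⟨s, hs, rfl⟩
    have : s = ∑ ρ, s ρ • (Pi.single ρ 1 : Δ.Ray → ℤ) := by
      funext ρ
      simp [Finset.sum_apply, Pi.single_apply]
    rw [this, map_sum]
    refine sum_mem fun ρ _ => ?_
    rw [map_zsmul]
    by_cases hρ : Δ.IsRayOf ρ σ
    · rw [hs ρ hρ, zero_zsmul]
      exact zero_mem _
    · have hcl : Δ.rayClass ρ ∈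
          AddSubgroup.closure {α | ∃ ρ, ¬ Δ.IsRayOf ρ σ ∧ α = Δ.rayClass ρ} :=
        AddSubgroup.subset_closure ⟨ρ, hρ, rfl⟩
      rw [rayClass] at hcl
      exact zsmul_mem hcl _

/-- If `B` is small, then `S_{Ẑ_σ}` has an invertible monomial of every degree in `B`, so that
every homogeneous element of `𝔞` has a multiple by such a monomial that contributes to `𝔞_(σ)`. -/
theorem le_of_locIdeal_le [B.FiniteIndex] (hB : Δ.IsSmall B) {𝔞 𝔟 : Ideal (Δ.coxRestrict R B)}
    (h𝔞 : 𝔞.IsHomogeneous (Δ.restrictGrading R B)) (h𝔟 : Δ.IsSaturated R B 𝔟)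
    (h : ∀ σ, Δ.locIdeal R B 𝔞 σ ≤ Δ.locIdeal R B 𝔟 σ) : 𝔞 ≤ 𝔟 := by
  classical
  have key : ∀ α ∈ B, ∀ f ∈ 𝔞, f.1 ∈ Δ.coxGrading R α → f ∈ 𝔟 := by
    intro α hα f hf𝔞 hf
    refine h𝔟.mem_of_forall Δ R fun σ => ?_
    obtain ⟨v, hv, rfl⟩ := (Δ.mem_closure_rayClass_iff σ α).1 ((AddSubgroup.mem_iInf.1 (hB hα)) σ)
    have hs : ∀ ρ, Δ.IsRayOf ρ σ → 0 ≤ (-v) ρ := fun ρ hρ => by simp [hv ρ hρ]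
    obtain ⟨x, hx⟩ := Δ.exists_chartToLaurent_eq R σ hf (map_neg Δ.toA v) hs
    obtain ⟨k, hk, g, hg𝔟, -, hxg⟩ := Δ.exists_of_mem_locIdeal R
      (h σ (Δ.mem_locIdeal_of_eq R hα hf𝔞 hf (map_neg Δ.toA v) hs hx))
    obtain ⟨K, hK⟩ := Δ.exists_le_nsmul_offRays σ (s := v - k • Δ.offRays σ) fun ρ hρ => by
      simp [hv ρ hρ, offRays_of_isRayOf hρ]
    obtain ⟨m, hKm, hm⟩ := Δ.exists_hatZ_pow_mem (B := B) σ K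
    obtain ⟨e, he⟩ := Δ.exists_expHom_eq (hK m hKm)
    have heB : Δ.toA (Δ.expHom e) ∈ B := by
      rw [he, map_add, map_sub, map_nsmul, map_nsmul, toA_offRays]
      exact add_mem (sub_mem hα hk) hm
    refine ⟨m, hm, ?_⟩
    have heq : f * Δ.hatPow R σ hm = g * Δ.restrictMonomial R heB 1 := by
      refine Subtype.ext (Δ.toLaurent_injective R ?_)
      rw [Subalgebra.coe_mul, Subalgebra.coe_mul, map_mul, map_mul, toLaurent_hatPow,
        coe_restrictMonomial, toLaurent_monomial, he,
        ← (Δ.isUnit_laurentMonomial R (-v)).mul_left_inj, mul_right_comm, ← hx, hxg, mul_assoc,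
        mul_assoc, ← laurentMonomial_add, ← laurentMonomial_add]
      congr 2
      abel
    rw [heq]
    exact 𝔟.mul_mem_right _ hg𝔟
  intro f hf
  rw [← DirectSum.sum_support_decompose (Δ.restrictGrading R B) f]
  exact sum_mem fun β _ => key β.1 β.2 _ (h𝔞 β hf)
    (DirectSum.decompose (Δ.restrictGrading R B) f β).2

/-! ### The graded ideal of a compatible family -/

theorem component_mul (f : Δ.Cox R) {g : Δ.Cox R} {α β : Δ.A} (hg : g ∈ Δ.coxGrading R β) :
    MvPolynomial.weightedHomogeneousComponent Δ.rayClass (α + β) (f * g) =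
      MvPolynomial.weightedHomogeneousComponent Δ.rayClass α f * g := by
  rw [← coe_decompose_cox, ← coe_decompose_cox]
  exact DirectSum.coe_decompose_mul_add_of_right_mem (Δ.coxGrading R) hg

/-- The graded ideal of the Cox ring defined by a family of ideals `J_σ` of the rings `S_(σ)`: it
consists of the polynomials for which every multiple of a homogeneous component by a Laurent
monomial without poles on `Y_σ`, if of degree zero, belongs to `J_σ`. -/
noncomputable def gradedIdeal (J : ∀ σ : Δ.Cone, Ideal (Δ.degZero R σ)) : Ideal (Δ.Cox R) where
  carrier := {f | ∀ (σ : Δ.Cone) (s : Δ.Ray → ℤ), (∀ ρ, Δ.IsRayOf ρ σ → 0 ≤ s ρ) →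
    ∃ x ∈ J σ, Δ.chartToLaurent R σ x =
      Δ.toLaurent R (MvPolynomial.weightedHomogeneousComponent Δ.rayClass (-Δ.toA s) f) *
        Δ.laurentMonomial R s}
  zero_mem' := fun σ s _ => ⟨0, zero_mem _, by rw [map_zero, map_zero, map_zero, zero_mul]⟩
  add_mem' := fun {f g} hf hg σ s hs => by
    obtain ⟨x, hx, hxf⟩ := hf σ s hs
    obtain ⟨y, hy, hyg⟩ := hg σ s hs
    exact ⟨x + y, add_mem hx hy, by rw [map_add, map_add, map_add, hxf, hyg, add_mul]⟩
  smul_mem' := fun c f hf => by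
    rw [smul_eq_mul, mul_comm]
    induction c using MvPolynomial.induction_on' with
    | monomial e c =>
      intro σ s hs
      obtain ⟨x, hx, hxf⟩ := hf σ (s + Δ.expHom e) fun ρ hρ =>
        add_nonneg (hs ρ hρ) (Int.natCast_nonneg _)
      obtain ⟨w, hw⟩ := Δ.exists_chartToLaurent_eq R σ (f := MvPolynomial.C c) (α := 0)
        (Δ.monomial_mem_coxGrading R (by rw [map_zero, map_zero]) c) (s := 0)
        (by rw [map_zero, neg_zero]) fun _ _ => le_rfl
      have h1 : -Δ.toA s = -Δ.toA (s + Δ.expHom e) + Δ.toA (Δ.expHom e) := by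
        rw [map_add]; abel
      have h2 : MvPolynomial.monomial e c = MvPolynomial.C c * MvPolynomial.monomial e 1 := by
        rw [MvPolynomial.C_mul_monomial, mul_one]
      refine ⟨w * x, (J σ).mul_mem_left w hx, ?_⟩
      rw [h1, Δ.component_mul R f (Δ.monomial_mem_coxGrading R rfl c), map_mul, hw, hxf, h2,
        map_mul, map_mul, toLaurent_monomial, laurentMonomial_add, laurentMonomial_zero]
      ring
    | add p q hp hq =>
      intro σ s hs
      obtain ⟨x, hx, hxf⟩ := hp σ s hs
      obtain ⟨y, hy, hyg⟩ := hq σ s hs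
      exact ⟨x + y, add_mem hx hy, by
        rw [mul_add, map_add, map_add, map_add, hxf, hyg, add_mul]⟩

variable (B) in
/-- The graded ideal of `S_B` defined by a family of ideals `J_σ` of the rings `S_(σ)`. -/
noncomputable def restrictGradedIdeal (J : ∀ σ : Δ.Cone, Ideal (Δ.degZero R σ)) :
    Ideal (Δ.coxRestrict R B) :=
  (Δ.gradedIdeal R J).comap (Δ.coxRestrict R B).val.toRingHom

variable {R}

theorem mem_restrictGradedIdeal {J : ∀ σ : Δ.Cone, Ideal (Δ.degZero R σ)}
    {f : Δ.coxRestrict R B} : f ∈ Δ.restrictGradedIdeal R B J ↔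
      ∀ (σ : Δ.Cone) (s : Δ.Ray → ℤ), (∀ ρ, Δ.IsRayOf ρ σ → 0 ≤ s ρ) →
        ∃ x ∈ J σ, Δ.chartToLaurent R σ x =
          Δ.toLaurent R (MvPolynomial.weightedHomogeneousComponent Δ.rayClass (-Δ.toA s) f.1) *
            Δ.laurentMonomial R s := Iff.rfl

theorem component_of_mem {f : Δ.Cox R} {α β : Δ.A} (hf : f ∈ Δ.coxGrading R α) :
    MvPolynomial.weightedHomogeneousComponent Δ.rayClass β f = if α = β then f else 0 := by
  rw [MvPolynomial.weightedHomogeneousComponent_of_mem hf]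
  simp only [eq_comm]

theorem isHomogeneous_restrictGradedIdeal (J : ∀ σ : Δ.Cone, Ideal (Δ.degZero R σ)) :
    (Δ.restrictGradedIdeal R B J).IsHomogeneous (Δ.restrictGrading R B) := by
  intro β f hf
  rw [mem_restrictGradedIdeal] at hf ⊢
  intro σ s hs
  have hmem : (DirectSum.decompose (Δ.restrictGrading R B) f β : Δ.coxRestrict R B).1 ∈
      Δ.coxGrading R β.1 := (DirectSum.decompose (Δ.restrictGrading R B) f β).2
  rw [Δ.component_of_mem hmem]
  split_ifs with h
  · rw [coe_decompose_restrict, coe_decompose_cox, h]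
    exact hf σ s hs
  · exact ⟨0, zero_mem _, by rw [map_zero, map_zero, zero_mul]⟩

theorem isSaturated_restrictGradedIdeal [B.FiniteIndex]
    (J : ∀ σ : Δ.Cone, Ideal (Δ.degZero R σ)) :
    Δ.IsSaturated R B (Δ.restrictGradedIdeal R B J) := by
  refine Δ.isSaturated_of_forall R fun f hf => ?_
  rw [mem_restrictGradedIdeal]
  intro σ s hs
  obtain ⟨k, hk, hfk⟩ := hf σ
  obtain ⟨x, hx, hxf⟩ := (Δ.mem_restrictGradedIdeal).1 hfk σ (s - k • Δ.offRays σ) fun ρ hρ => by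
    simpa [offRays_of_isRayOf hρ] using hs ρ hρ
  refine ⟨x, hx, ?_⟩
  have h1 : -Δ.toA (s - k • Δ.offRays σ) = -Δ.toA s + k • Δ.hatDeg σ := by
    rw [map_sub, map_nsmul, toA_offRays]; abel
  have h2 : (Δ.hatPow R σ hk).1 ∈ Δ.coxGrading R (k • Δ.hatDeg σ) :=
    SetLike.pow_mem_graded k (Δ.hatZ_mem R σ)
  rw [hxf, h1, Subalgebra.coe_mul, Δ.component_mul R f.1 h2, map_mul, toLaurent_hatPow,
    mul_assoc, ← laurentMonomial_add, add_sub_cancel]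

/-- The graded ideal defined by a compatible family recovers the family. A section of `J_σ`,
written as a fraction with denominator a power of `Ẑ_σ`, has its numerator in the graded ideal as
soon as this is multiplied by a high power of `Ẑ_σ`: this cancels the poles along the complement
of `Y_{σ ∩ τ}` in `Y_τ`, which are of bounded order on the part coming from the given section. -/
theorem locIdeal_restrictGradedIdeal [B.FiniteIndex] {J : ∀ σ : Δ.Cone, Ideal (Δ.degZero R σ)}
    (hJ : Δ.IsCompatible R J) (σ : Δ.Cone) :
    Δ.locIdeal R B (Δ.restrictGradedIdeal R B J) σ = J σ := by
  apply le_antisymm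
  · intro x hx
    obtain ⟨k, hk, f, hf, hfk, hxf⟩ := Δ.exists_of_mem_locIdeal R hx
    obtain ⟨y, hy, hyf⟩ := (Δ.mem_restrictGradedIdeal).1 hf σ (-(k • Δ.offRays σ)) fun ρ hρ => by
      simp [offRays_of_isRayOf hρ]
    rw [Δ.component_of_mem hfk, if_pos, ← hxf] at hyf
    · rwa [← Δ.chartToLaurent_injective R σ hyf]
    · rw [map_neg, map_nsmul, toA_offRays, neg_neg]
  · intro x hx
    have hτ : ∀ τ : Δ.Cone, ∃ (u : dualLattice N) (_ : CutsOut u.1 (Δ.inter σ τ).1 τ.1) (j : ℕ),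
        ∃ y ∈ J τ, Δ.chartToLaurent R τ y =
          Δ.chartToLaurent R σ x * Δ.laurentMonomial R (j • Δ.charMap u) := by
      intro τ
      obtain ⟨u, huM, hu⟩ := (Δ.le_iff_isFace _ _).1 (Δ.inter_le_right σ τ)
      have h1 : Δ.degZeroMap R (Δ.inter_le_left σ τ) x ∈ J (Δ.inter σ τ) := by
        rw [hJ (Δ.inter_le_left σ τ)]
        exact Ideal.mem_map_of_mem _ hx
      rw [hJ (Δ.inter_le_right σ τ),
        Δ.mem_map_degZeroMap_iff R (Δ.inter_le_right σ τ) (u := ⟨u, huM⟩) hu,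
        chartToLaurent_degZeroMap] at h1
      exact ⟨⟨u, huM⟩, hu, h1⟩
    choose u hu j y hy hyx using hτ
    choose K hK using fun τ => Δ.exists_bound (u τ)
    obtain ⟨M, hM⟩ := Finite.exists_le fun τ => j τ * K τ
    obtain ⟨k, f, hf, rfl⟩ := HomogeneousLocalization.Away.mk_surjective _ (Δ.hatZ_mem R σ) x
    rw [chartToLaurent_mk] at hyx
    obtain ⟨l, hl, hlB⟩ := Δ.exists_hatZ_pow_mem (B := B) σ (k + M)
    obtain ⟨m, rfl⟩ := Nat.exists_eq_add_of_le (le_of_add_le_left hl)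
    have hMm : M ≤ m := le_of_add_le_add_left hl
    have hgmem : f * Δ.hatZ R σ ^ m ∈ Δ.coxGrading R ((k + m) • Δ.hatDeg σ) := by
      rw [add_nsmul]
      exact SetLike.mul_mem_graded hf (SetLike.pow_mem_graded m (Δ.hatZ_mem R σ))
    let g : Δ.coxRestrict R B := ⟨f * Δ.hatZ R σ ^ m, Δ.mem_coxRestrict_of_mem R B hlB hgmem⟩
    have hgL : Δ.toLaurent R g.1 = Δ.toLaurent R f * Δ.laurentMonomial R (m • Δ.offRays σ) := by
      rw [laurentMonomial_nsmul, ← toLaurent_hatZ, ← map_pow, ← map_mul]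
    have hg : g ∈ Δ.restrictGradedIdeal R B J := by
      rw [mem_restrictGradedIdeal]
      intro τ s hs
      rw [Δ.component_of_mem hgmem]
      split_ifs with hdeg
      · -- The remaining factor is a monomial without poles on `Y_τ`.
        obtain ⟨w, hw⟩ := Δ.exists_chartToLaurent_eq_laurentMonomial R τ
          (s := (k + m) • Δ.offRays σ + s - j τ • Δ.charMap (u τ)) (by
            rw [map_sub, map_add, map_nsmul, map_nsmul, toA_charMap, toA_offRays, hdeg, nsmul_zero,
              neg_add_cancel, sub_zero]) (by
            intro ρ hρ
            simp only [Pi.sub_apply, Pi.add_apply, Pi.smul_apply]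
            have hsρ := hs ρ hρ
            by_cases hρσ : Δ.IsRayOf ρ σ
            · rw [offRays_of_isRayOf hρσ,
                (Δ.charMap_eq_zero_iff (hu τ) hρ).2 (Δ.le_inter hρσ hρ)]
              simpa using hsρ
            · rw [offRays_of_not_isRayOf hρσ, nsmul_eq_mul, nsmul_eq_mul]
              have h1 : (j τ : ℤ) * Δ.charMap (u τ) ρ ≤ (j τ * K τ : ℕ) := by
                push_cast
                exact mul_le_mul_of_nonneg_left (abs_le.1 (hK τ ρ)).2 (Int.natCast_nonneg _)
              have h2 := hM τ
              push_cast
              lia)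
        refine ⟨y τ * w, (J τ).mul_mem_right w (hy τ), ?_⟩
        rw [map_mul, hyx, hw, hgL, mul_assoc, mul_assoc, mul_assoc, ← laurentMonomial_add,
          ← laurentMonomial_add, ← laurentMonomial_add]
        congr 2
        rw [add_nsmul]
        abel
      · exact ⟨0, zero_mem _, by rw [map_zero, map_zero, zero_mul]⟩
    refine Δ.mem_locIdeal_of_eq R hlB hg hgmem (s := -((k + m) • Δ.offRays σ)) ?_ ?_ ?_
    · rw [map_neg, map_nsmul, toA_offRays]
    · intro ρ hρ
      simp [offRays_of_isRayOf hρ]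
    · rw [chartToLaurent_mk, hgL, mul_assoc, ← laurentMonomial_add]
      congr 2
      rw [add_nsmul]
      abel

/-! ### The map `Ξ_B` -/

section Bijectivity

variable [B.FiniteIndex]

theorem eq_Xi_iff (𝔞 : Δ.SaturatedIdeal R B) (J : (Δ.coxScheme R).IdealSheafData) :
    J = Δ.Xi R B 𝔞 ↔ ∀ σ, J.comap (Δ.coxChart R σ) = Δ.locIdealSheaf R B 𝔞.1 σ :=
  (Δ.isCompatible_locIdeal R 𝔞.1).eq_iInf_map_iff Δ J

variable (R B)

theorem Xi_surjective : Function.Surjective (Δ.Xi R B) := by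
  intro J
  obtain ⟨K, hK, hJ⟩ := Δ.exists_isCompatible J
  refine ⟨⟨Δ.restrictGradedIdeal R B K, Δ.isHomogeneous_restrictGradedIdeal K,
    Δ.isSaturated_restrictGradedIdeal K⟩, ((Δ.eq_Xi_iff _ J).2 fun σ => ?_).symm⟩
  rw [hJ, locIdealSheaf, Δ.locIdeal_restrictGradedIdeal hK]
  rfl

variable {B} in
theorem Xi_injective (hB : Δ.IsSmall B) : Function.Injective (Δ.Xi R B) := by
  intro 𝔞 𝔟 h
  have hloc : ∀ σ, Δ.locIdeal R B 𝔞.1 σ = Δ.locIdeal R B 𝔟.1 σ := fun σ =>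
    (Δ.chartIdeal_bijective R σ).1
      (((Δ.eq_Xi_iff 𝔞 _).1 rfl σ).symm.trans ((Δ.eq_Xi_iff 𝔟 _).1 h σ))
  exact Subtype.ext <| le_antisymm
    (Δ.le_of_locIdeal_le R hB 𝔞.2.1 𝔟.2.2 fun σ => (hloc σ).le)
    (Δ.le_of_locIdeal_le R hB 𝔟.2.1 𝔞.2.2 fun σ => (hloc σ).ge)

end Bijectivity

end SaturatedIdeals

end Fan

/-! ### Integral forms and cones generated by lattice points -/

section Lattice

variable {V : Type v} [AddCommGroup V] [Module ℝ V]

/-- A `ℤ`-structure is the group of integral points with respect to some basis. -/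
theorem exists_basis_of_isZStructure [FiniteDimensional ℝ V] (N : AddSubgroup V)
    [IsZStructure N] : ∃ (n : ℕ) (e : Module.Basis (Fin n) ℝ V),
      ∀ y ∈ N, ∃ c : Fin n → ℤ, y = ∑ i, c i • e i := by
  have : AddGroup.FG N := (AddGroup.fg_iff_addSubgroup_fg N).mpr IsZStructure.fg
  have : Module.Finite ℤ N := Module.Finite.iff_addGroup_fg.mpr this
  have : IsAddTorsionFree V := by
    let : Module ℚ V := Module.compHom V (algebraMap ℚ ℝ)
    exact .of_module_rat _
  have : Module.Free ℤ N := inferInstance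
  let b := Module.finBasis ℤ N
  have hspan : ∀ y ∈ N, ∃ c : Fin (Module.finrank ℤ N) → ℤ, y = ∑ i, c i • (b i : V) := by
    intro y hy
    refine ⟨fun i => b.repr ⟨y, hy⟩ i, ?_⟩
    have h := congrArg (N.subtype) (b.sum_repr ⟨y, hy⟩)
    rw [map_sum] at h
    simp only [map_zsmul, AddSubgroup.subtype_apply] at h
    exact h.symm
  have htop : ⊤ ≤ Submodule.span ℝ (Set.range fun i => (b i : V)) := by
    rw [← IsZStructure.span (N := N)]
    refine Submodule.span_le.mpr fun y hy => ?_
    obtain ⟨c, rfl⟩ := hspan y hy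
    refine Submodule.sum_mem _ fun i _ => ?_
    exact zsmul_mem (Submodule.subset_span (Set.mem_range_self i)) _
  let e := basisOfTopLeSpanOfCardEqFinrank _ htop
    (by rw [Fintype.card_fin]; exact IsZStructure.rank)
  have he : ∀ i, e i = (b i : V) := fun i => by simp [e]
  exact ⟨_, e, by simpa only [he] using hspan⟩

/-- Linearly independent lattice points can be assigned arbitrary values, up to a common
multiple, by integral linear forms. -/
theorem exists_dual_eq_mul [FiniteDimensional ℝ V] (N : AddSubgroup V) [IsZStructure N]
    {ι : Type*} [Finite ι] {x : ι → V} (hxN : ∀ i, x i ∈ N) (hx : LinearIndependent ℝ x) :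
    ∃ d : ℕ, 0 < d ∧ ∀ c : ι → ℤ, ∃ u ∈ dualLattice N, ∀ i, u (x i) = d * c i := by
  classical
  have := Fintype.ofFinite ι
  obtain ⟨n, e, he⟩ := exists_basis_of_isZStructure N
  choose a ha using fun i => he (x i) (hxN i)
  let y : ι → Fin n → ℚ := fun i k => a i k
  have hy : LinearIndependent ℚ y := by
    let g : (Fin n → ℚ) →ₗ[ℚ] (Fin n → ℝ) := (Algebra.linearMap ℚ ℝ).compLeft (Fin n)
    have h1 : LinearIndependent ℚ (e.equivFun ∘ x) :=
      (hx.map' e.equivFun.toLinearMap (LinearEquiv.ker _)).restrict_scalars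
        (Algebra.algebraMap_eq_smul_one' (R := ℚ) (A := ℝ) ▸ (algebraMap ℚ ℝ).injective)
    have h2 : e.equivFun ∘ x = g ∘ y := by
      funext i k
      simp only [Function.comp_apply, ha i, map_sum, map_zsmul, Module.Basis.equivFun_self,
        Finset.sum_apply, Pi.smul_apply]
      simp [g, y]
    rw [h2] at h1
    exact LinearIndependent.of_comp g h1
  obtain ⟨ψ, hψ⟩ := LinearMap.exists_leftInverse_of_injective
    (Finsupp.linearCombination ℚ y) (LinearMap.ker_eq_bot.2 hy)
  have hψy : ∀ i, ψ (y i) = Finsupp.single i 1 := fun i => by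
    have := LinearMap.congr_fun hψ (Finsupp.single i 1)
    simpa using this
  obtain ⟨d, hd⟩ := IsLocalization.exist_integer_multiples_of_finite (nonZeroDivisors ℤ)
    (fun p : Fin n × ι => ψ (Pi.single p.1 1) p.2)
  have hd0 : (d : ℤ) ≠ 0 := nonZeroDivisors.coe_ne_zero d
  choose z hz using hd
  -- The form with values `∑ i, c i * z (k, i)` on the basis takes the value `d * c i` on `x i`.
  have hsum : ∀ i j, ∑ k, a i k * z (k, j) = if i = j then (d : ℤ) else 0 := by
    intro i j
    have h1 : y i = ∑ k, (a i k : ℚ) • (Pi.single k 1 : Fin n → ℚ) := by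
      funext k
      simp [y, Finset.sum_apply, Pi.single_apply]
    have h2 := congrArg (fun f => (d : ℚ) * f j) (hψy i)
    simp only [h1, map_sum, map_smul, Finsupp.finsetSum_apply, Finsupp.smul_apply,
      Finsupp.single_apply, Finset.mul_sum] at h2
    have h3 : ∀ k, (z (k, j) : ℚ) = (d : ℚ) * ψ (Pi.single k 1) j := fun k => by
      simpa [Algebra.smul_def] using hz (k, j)
    have h4 : ((∑ k, a i k * z (k, j) : ℤ) : ℚ) = ((if i = j then (d : ℤ) else 0 : ℤ) : ℚ) := by
      push_cast
      rw [← mul_one (d : ℚ), ← mul_zero (d : ℚ), ← mul_ite, ← h2]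
      refine Finset.sum_congr rfl fun k _ => ?_
      rw [h3, smul_eq_mul]
      ring
    exact_mod_cast h4
  refine ⟨(d : ℤ).natAbs, Int.natAbs_pos.2 hd0, fun c => ?_⟩
  let w : Fin n → ℤ := fun k => (d : ℤ).sign * ∑ j, c j * z (k, j)
  refine ⟨e.constr ℝ fun k => (w k : ℝ), fun p hp => ?_, fun i => ?_⟩
  · obtain ⟨b, rfl⟩ := he p hp
    exact ⟨∑ k, b k * w k, by simp⟩
  · have h1 : ∑ k, a i k * w k = (d : ℤ).natAbs * c i := by
      have h2 : ∑ k, a i k * w k = (d : ℤ).sign * ∑ j, c j * ∑ k, a i k * z (k, j) := by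
        simp only [w, Finset.mul_sum]
        rw [Finset.sum_comm]
        refine Finset.sum_congr rfl fun j _ => Finset.sum_congr rfl fun k _ => by ring
      rw [h2]
      simp only [hsum, mul_ite, mul_zero, Finset.sum_ite_eq, Finset.mem_univ, if_true]
      rw [mul_comm (c i), ← mul_assoc, Int.sign_mul_self_eq_natAbs]
    have h3 : ((∑ k, a i k * w k : ℤ) : ℝ) = (((d : ℤ).natAbs * c i : ℤ) : ℝ) := by rw [h1]
    rw [ha i]
    push_cast at h3
    simp [h3]

/-- The part of a cone where a form that is nonnegative on the generators vanishes is generated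
by the generators in the kernel of the form. -/
theorem mem_hull_inter_ker {s : Set V} {u : Module.Dual ℝ V} (hu : ∀ x ∈ s, 0 ≤ u x) {x : V}
    (hx : x ∈ PointedCone.hull ℝ s) :
    0 ≤ u x ∧ (u x = 0 → x ∈ PointedCone.hull ℝ {y ∈ s | u y = 0}) := by
  induction hx using Submodule.span_induction with
  | mem x h => exact ⟨hu x h, fun h0 => Submodule.subset_span ⟨h, h0⟩⟩
  | zero => exact ⟨(map_zero u).ge, fun _ => zero_mem _⟩
  | add x y _ _ hx hy =>
    rw [map_add]
    exact ⟨add_nonneg hx.1 hy.1, fun h0 => add_mem (hx.2 (by linarith [hx.1, hy.1]))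
      (hy.2 (by linarith [hx.1, hy.1]))⟩
  | smul r x _ hx =>
    have hr : u (r • x) = r.1 * u x := map_smul u r.1 x
    rw [hr]
    refine ⟨mul_nonneg r.2 hx.1, fun h0 => ?_⟩
    rcases mul_eq_zero.1 h0 with h | h
    · have : r = 0 := Subtype.ext h
      rw [this, zero_smul]
      exact zero_mem _
    · exact Submodule.smul_mem _ r (hx.2 h)

theorem exists_ne_zero_of_mem_hull {s : Set V} {x : V} (hx : x ∈ PointedCone.hull ℝ s)
    (h0 : x ≠ 0) : ∃ y ∈ s, y ≠ 0 := by
  by_contra! h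
  have : PointedCone.hull ℝ s = ⊥ := Submodule.span_eq_bot.2 h
  rw [this] at hx
  exact h0 hx

theorem mem_hull_singleton {x y : V} :
    y ∈ PointedCone.hull ℝ {x} ↔ ∃ r : ℝ, 0 ≤ r ∧ y = r • x := by
  rw [PointedCone.hull, Submodule.mem_span_singleton]
  exact ⟨fun ⟨r, h⟩ => ⟨r.1, r.2, h.symm⟩, fun ⟨r, hr, h⟩ => ⟨⟨r, hr⟩, h.symm⟩⟩

/-- The generators of a simplicial polycone can be chosen in the lattice. -/
theorem exists_generators_of_isSimplicial {N : AddSubgroup V} {σ : PointedCone ℝ V}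
    (hσN : IsPolycone N σ) (hσ : σ.IsSimplicial) :
    ∃ (s : Set V) (x : s → V), s.Finite ∧ (∀ i, x i ∈ N) ∧ LinearIndependent ℝ x ∧
      σ = PointedCone.hull ℝ (Set.range x) := by
  classical
  obtain ⟨t, htN, ht⟩ := hσN
  obtain ⟨s, hs, hli, hsσ⟩ := hσ
  have hscale : ∀ v : s, ∃ r : ℝ, 0 < r ∧ r • v.1 ∈ N := by
    intro v
    -- The form `φ`, zero on `v` and one on the other generators, cuts out the ray of `v`, and this
    -- ray contains one of the generators in the lattice.
    let e := Module.Basis.extend hli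
    let φ : Module.Dual ℝ V := e.constr ℝ fun w => if w.1 = v.1 then 0 else 1
    have hφ : ∀ w ∈ s, φ w = if w = v.1 then 0 else 1 := by
      intro w hw
      have h1 := e.constr_basis ℝ (fun w => if w.1 = v.1 then (0 : ℝ) else 1)
        ⟨w, hli.subset_extend _ hw⟩
      rwa [Module.Basis.extend_apply_self] at h1
    have hφ0 : ∀ w ∈ s, 0 ≤ φ w := fun w hw => by
      rw [hφ w hw]
      split_ifs
      · exact le_rfl
      · exact zero_le_one
    have hv0 : v.1 ≠ 0 := hli.ne_zero v.2
    have hφv : φ v = 0 := by rw [hφ v.1 v.2, if_pos rfl]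
    have hvσ : v.1 ∈ PointedCone.hull ℝ (t : Set V) := by
      rw [← ht, ← hsσ]
      exact Submodule.subset_span v.2
    have hts : ∀ y ∈ t, y ∈ PointedCone.hull ℝ s := fun y hy => by
      rw [hsσ, ht]
      exact Submodule.subset_span hy
    obtain ⟨y, ⟨hyt, hy⟩, hy0⟩ := exists_ne_zero_of_mem_hull
      ((mem_hull_inter_ker (fun y hy => (mem_hull_inter_ker hφ0 (hts y hy)).1) hvσ).2 hφv) hv0
    have h2 := (mem_hull_inter_ker hφ0 (hts y hyt)).2 hy
    have h3 : {w ∈ s | φ w = 0} ⊆ {v.1} := fun w hw => by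
      by_contra hne
      have := hφ w hw.1
      rw [if_neg (show w ≠ v.1 from hne), hw.2] at this
      exact zero_ne_one this
    obtain ⟨r, hr, rfl⟩ := mem_hull_singleton.1 (Submodule.span_mono h3 h2)
    exact ⟨r, hr.lt_of_ne (fun h => hy0 (by rw [← h, zero_smul])), htN hyt⟩
  choose r hr hrN using hscale
  refine ⟨s, fun v => r v • v.1, hs, hrN, ?_, ?_⟩
  · exact (linearIndependent_subtype_iff.2 hli).units_smul fun v => Units.mk0 (r v) (hr v).ne'
  · rw [← hsσ]
    apply le_antisymm
    · refine Submodule.span_le.2 fun v hv => ?_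
      have h1 := PointedCone.smul_mem (PointedCone.hull ℝ (Set.range fun v : s => r v • v.1))
        (inv_nonneg.2 (hr ⟨v, hv⟩).le)
        (Submodule.subset_span (Set.mem_range_self (⟨v, hv⟩ : s)))
      rwa [inv_smul_smul₀ (hr ⟨v, hv⟩).ne'] at h1
    · refine Submodule.span_le.2 ?_
      rintro _ ⟨v, rfl⟩
      exact PointedCone.smul_mem _ (hr v).le (Submodule.subset_span v.2)

end Lattice

namespace Fan

/-! ### The Picard group of a fan -/

section Picard

variable {V : Type v} [AddCommGroup V] [Module ℝ V] [FiniteDimensional ℝ V] {N : AddSubgroup V}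
  [IsZStructure N] (Δ : Fan N)

theorem rayGen_mem (ρ : Δ.Ray) : Δ.rayGen ρ ∈ ρ.1.1 :=
  ((Δ.rayGen_spec ρ).2.1 _).2 ⟨1, zero_le_one, (one_smul _ _).symm⟩

theorem rayGen_ne_zero (ρ : Δ.Ray) : Δ.rayGen ρ ≠ 0 := by
  intro h
  have h1 : ρ.1.1 = ⊥ := by
    refine (Submodule.eq_bot_iff _).2 fun y hy => ?_
    obtain ⟨r, -, rfl⟩ := ((Δ.rayGen_spec ρ).2.1 y).1 hy
    rw [h, smul_zero]
  have h2 := ρ.2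
  rw [h1, show ((⊥ : PointedCone ℝ V) : Set V) = {0} from rfl, Submodule.span_zero_singleton,
    finrank_bot] at h2
  exact zero_ne_one h2

/-- Subtracting `m_σ` from a family `(m_ρ)` makes its values on the rays of `σ` vanish. -/
theorem isSmall_pic : Δ.IsSmall Δ.pic := by
  refine le_iInf fun σ => ?_
  rintro _ ⟨_, ⟨m, hm, rfl⟩, rfl⟩
  rw [mem_closure_rayClass_iff]
  refine ⟨Δ.rayValues m - Δ.charMap (m σ), fun ρ hρ => ?_, by rw [map_sub, toA_charMap, sub_zero]⟩
  have h1 : (Δ.charMap (m σ) ρ : ℝ) = Δ.charMap (m ρ.1) ρ := by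
    rw [charMap_spec, charMap_spec]
    exact hm ρ.1 σ hρ _ (Δ.rayGen_mem ρ)
  rw [Pi.sub_apply, sub_eq_zero]
  exact_mod_cast h1.symm

/-- Every generator of a simplicial cone spans a face: multiples of the other generators are
separated from it by an integral form. -/
theorem exists_ray_of_generators {σ : Δ.Cone} {ι : Type*} [Finite ι] {x : ι → V}
    (hxN : ∀ i, x i ∈ N) (hx : LinearIndependent ℝ x)
    (hσ : σ.1 = PointedCone.hull ℝ (Set.range x)) (i : ι) :
    ∃ ρ : Δ.Ray, Δ.IsRayOf ρ σ ∧ ρ.1.1 = PointedCone.hull ℝ {x i} := by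
  classical
  obtain ⟨d, hd, h⟩ := exists_dual_eq_mul N hxN hx
  obtain ⟨u, huN, hu⟩ := h fun j => if j = i then 0 else 1
  have hu0 : ∀ y ∈ Set.range x, 0 ≤ u y := by
    rintro _ ⟨j, rfl⟩
    rw [hu]
    split_ifs <;> simp
  have hface : CutsOut u (PointedCone.hull ℝ {x i}) σ.1 := by
    rw [hσ]
    refine ⟨fun y hy => (mem_hull_inter_ker hu0 hy).1, fun y => ⟨fun hy => ⟨?_, ?_⟩, ?_⟩⟩
    · exact Submodule.span_mono (Set.singleton_subset_iff.2 (Set.mem_range_self i)) hy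
    · obtain ⟨r, -, rfl⟩ := mem_hull_singleton.1 hy
      rw [map_smul, hu, if_pos rfl]
      simp
    · rintro ⟨hy, h0⟩
      refine Submodule.span_mono ?_ ((mem_hull_inter_ker hu0 hy).2 h0)
      rintro _ ⟨⟨j, rfl⟩, hj⟩
      rw [hu] at hj
      by_contra hne
      rw [if_neg (fun hji => hne (by rw [hji]; rfl))] at hj
      simp [hd.ne'] at hj
  have hmem := Δ.face_mem σ.1 σ.2 _ ⟨u, huN, hface⟩
  refine ⟨⟨⟨_, hmem⟩, ?_⟩, fun y hy => ((hface.2 y).1 hy).1, rfl⟩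
  have hspan : Submodule.span ℝ ((PointedCone.hull ℝ {x i} : PointedCone ℝ V) : Set V) =
      Submodule.span ℝ {x i} := by
    apply le_antisymm
    · refine Submodule.span_le.2 fun y hy => ?_
      obtain ⟨r, -, rfl⟩ := mem_hull_singleton.1 hy
      exact Submodule.smul_mem _ r (Submodule.mem_span_singleton_self _)
    · exact Submodule.span_mono Submodule.subset_span
  change Module.finrank ℝ (Submodule.span ℝ
    ((PointedCone.hull ℝ {x i} : PointedCone ℝ V) : Set V)) = 1
  rw [hspan]
  exact finrank_span_singleton (hx.ne_zero i)

/-- The minimal generators of the rays of a simplicial cone are linearly independent and generate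
the cone: they are the given generators up to positive scalars. -/
theorem linearIndependent_rayGen {σ : Δ.Cone} (hσ : σ.1.IsSimplicial) :
    LinearIndependent ℝ (fun ρ : {ρ : Δ.Ray // Δ.IsRayOf ρ σ} => Δ.rayGen ρ.1) ∧
      σ.1 = PointedCone.hull ℝ {y | ∃ ρ, Δ.IsRayOf ρ σ ∧ y = Δ.rayGen ρ} := by
  obtain ⟨s, x, hs, hxN, hx, hσx⟩ :=
    exists_generators_of_isSimplicial (Δ.polycone σ.1 σ.2) hσ
  have := hs.to_subtype
  constructor
  · have h : ∀ ρ : {ρ : Δ.Ray // Δ.IsRayOf ρ σ}, ∃ (i : s) (r : ℝ), 0 < r ∧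
        x i = r • Δ.rayGen ρ.1 := by
      rintro ⟨ρ, hρ⟩
      obtain ⟨u, -, hu⟩ := (Δ.le_iff_isFace ρ.1 σ).1 hρ
      obtain ⟨hgσ, hg0⟩ := (hu.2 _).1 (Δ.rayGen_mem ρ)
      have hu0 : ∀ y ∈ Set.range x, 0 ≤ u y := fun y hy => hu.1 y (by
        rw [hσx]
        exact Submodule.subset_span hy)
      rw [hσx] at hgσ
      obtain ⟨_, ⟨⟨i, rfl⟩, hi⟩, hi0⟩ := exists_ne_zero_of_mem_hull
        ((mem_hull_inter_ker hu0 hgσ).2 hg0) (Δ.rayGen_ne_zero ρ)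
      have hiρ : x i ∈ ρ.1.1 := (hu.2 _).2 ⟨by
        rw [hσx]
        exact Submodule.subset_span (Set.mem_range_self i), hi⟩
      obtain ⟨r, hr, hir⟩ := ((Δ.rayGen_spec ρ).2.1 _).1 hiρ
      exact ⟨i, r, hr.lt_of_ne (fun h => hi0 (by rw [hir, ← h, zero_smul])), hir⟩
    choose i r hr hir using h
    have hgen : ∀ ρ, Δ.rayGen ρ.1 = (r ρ)⁻¹ • x (i ρ) := fun ρ => by
      rw [hir, inv_smul_smul₀ (hr ρ).ne']
    have hinj : Function.Injective i := by
      have hle : ∀ ρ ρ', i ρ = i ρ' → ρ.1.1.1 ≤ ρ'.1.1.1 := by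
        intro ρ ρ' h y hy
        obtain ⟨t, ht, rfl⟩ := ((Δ.rayGen_spec ρ.1).2.1 y).1 hy
        rw [hgen, h, hir ρ', smul_smul, smul_smul]
        exact PointedCone.smul_mem _
          (mul_nonneg (mul_nonneg ht (inv_nonneg.2 (hr ρ).le)) (hr ρ').le) (Δ.rayGen_mem _)
      intro ρ ρ' h
      exact Subtype.ext (Subtype.ext (Subtype.ext (le_antisymm (hle ρ ρ' h) (hle ρ' ρ h.symm))))
    have h1 := (hx.comp i hinj).units_smul fun ρ => (Units.mk0 (r ρ) (hr ρ).ne')⁻¹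
    convert h1 using 1
    funext ρ
    rw [hgen]
    rfl
  · apply le_antisymm
    · rw [hσx]
      refine Submodule.span_le.2 ?_
      rintro _ ⟨i, rfl⟩
      obtain ⟨ρ, hρσ, hρ⟩ := Δ.exists_ray_of_generators hxN hx hσx i
      have hi : x i ∈ ρ.1.1 := by
        rw [hρ]
        exact Submodule.subset_span rfl
      obtain ⟨r, hr, hir⟩ := ((Δ.rayGen_spec ρ).2.1 _).1 hi
      rw [hir]
      exact PointedCone.smul_mem _ hr (Submodule.subset_span ⟨ρ, hρσ, rfl⟩)
    · refine Submodule.span_le.2 ?_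
      rintro _ ⟨ρ, hρ, rfl⟩
      exact hρ (Δ.rayGen_mem ρ)

/-- On a simplicial fan, every integral function on the rays has a multiple that is given on each
cone by an integral linear form. -/
theorem exists_nsmul_mem_pic (hΔ : Δ.IsSimplicial) : ∃ d : ℕ, 0 < d ∧ ∀ α : Δ.A, d • α ∈ Δ.pic := by
  have := Fintype.ofFinite Δ.Cone
  choose d hd h using fun σ : Δ.Cone => exists_dual_eq_mul N
    (fun ρ : {ρ : Δ.Ray // Δ.IsRayOf ρ σ} => (Δ.rayGen_spec ρ.1).1)
    (Δ.linearIndependent_rayGen (hΔ σ.1 σ.2)).1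
  refine ⟨∏ σ, d σ, Finset.prod_pos fun σ _ => hd σ, fun α => ?_⟩
  obtain ⟨c, rfl⟩ := QuotientAddGroup.mk'_surjective _ α
  have hu : ∀ σ : Δ.Cone, ∃ u : dualLattice N, ∀ ρ, Δ.IsRayOf ρ σ →
      u.1 (Δ.rayGen ρ) = (∏ σ, d σ : ℕ) * c ρ := by
    intro σ
    obtain ⟨k, hk⟩ := Finset.dvd_prod_of_mem d (Finset.mem_univ σ)
    obtain ⟨u, huN, hu⟩ := h σ fun ρ => k * c ρ.1
    refine ⟨⟨u, huN⟩, fun ρ hρ => (hu ⟨ρ, hρ⟩).trans ?_⟩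
    rw [hk]
    push_cast
    ring
  choose m hm using hu
  refine ⟨_, ⟨m, ?_, rfl⟩, ?_⟩
  · intro τ σ hτσ x hx
    rw [(Δ.linearIndependent_rayGen (hΔ τ.1 τ.2)).2] at hx
    induction hx using Submodule.span_induction with
    | mem x hx =>
      obtain ⟨ρ, hρ, rfl⟩ := hx
      rw [hm τ ρ hρ, hm σ ρ (le_trans hρ hτσ)]
    | zero => rw [map_zero, map_zero]
    | add x y _ _ hx hy => rw [map_add, map_add, hx, hy]
    | smul r x _ hx =>
      exact (map_smul (m σ).1 r.1 x).trans ((congrArg _ hx).trans (map_smul (m τ).1 r.1 x).symm)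
  · rw [← map_nsmul]
    congr 1
    funext ρ
    have h1 : (Δ.charMap (m ρ.1) ρ : ℝ) = (((∏ σ, d σ) • c) ρ : ℤ) := by
      rw [charMap_spec, hm ρ.1 ρ le_rfl]
      simp
    exact_mod_cast h1

theorem finiteIndex_pic (hΔ : Δ.IsSimplicial) : Δ.pic.FiniteIndex := by
  obtain ⟨d, hd, h⟩ := Δ.exists_nsmul_mem_pic hΔ
  have : Module.Finite ℤ (Δ.A ⧸ Δ.pic) :=
    Module.Finite.of_surjective
      (AddMonoidHom.toIntLinearMap ((QuotientAddGroup.mk' Δ.pic).comp Δ.toA))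
      ((QuotientAddGroup.mk'_surjective _).comp (QuotientAddGroup.mk'_surjective _))
  have : Finite (Δ.A ⧸ Δ.pic) := by
    refine AddCommGroup.finite_of_fg_isAddTorsion _
      (hG' := Module.Finite.iff_addGroup_fg.1 inferInstance) fun x => ?_
    obtain ⟨α, rfl⟩ := QuotientAddGroup.mk'_surjective _ x
    refine isOfFinAddOrder_iff_nsmul_eq_zero.2 ⟨d, hd, ?_⟩
    rw [← map_nsmul]
    exact (QuotientAddGroup.eq_zero_iff _).2 (h α)
  exact AddSubgroup.finiteIndex_of_finite_quotient

end Picard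

end Fan

end Toric

theorem mainTheorem3 {V : Type v} [AddCommGroup V] [Module ℝ V] [FiniteDimensional ℝ V]
    (N : AddSubgroup V) [Toric.IsZStructure N] (Δ : Toric.Fan N) (R : Type u) [CommRing R] :
    (∀ (B : AddSubgroup Δ.A) [B.FiniteIndex],
      (∀ (𝔞 : Δ.SaturatedIdeal R B) (J : (Δ.coxScheme R).IdealSheafData),
        J = Δ.Xi R B 𝔞 ↔
          ∀ σ : Δ.Cone, J.comap (Δ.coxChart R σ) = Δ.locIdealSheaf R B 𝔞.1 σ) ∧
      Function.Surjective (Δ.Xi R B) ∧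
      (Δ.IsSmall B → Function.Bijective (Δ.Xi R B))) ∧
    Δ.IsSmall Δ.pic ∧
    (Δ.IsSimplicial → ∃ _ : Δ.pic.FiniteIndex, Function.Bijective (Δ.Xi R Δ.pic)) := by
  refine ⟨fun B _ => ⟨Δ.eq_Xi_iff, Δ.Xi_surjective R B,
    fun hB => ⟨Δ.Xi_injective R hB, Δ.Xi_surjective R B⟩⟩, Δ.isSmall_pic, fun hΔ => ?_⟩
  have := Δ.finiteIndex_pic hΔ
  exact ⟨this, Δ.Xi_injective R Δ.isSmall_pic, Δ.Xi_surjective R Δ.pic⟩
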